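/- Let $\alpha>2$, $C_d,C_r,d_0>0$, $p\in[0,1]$, $N\ge 1$ an integer, $m_h,m_r\ge\tfrac12$, $\lambda_t>0$. Transmitters (TXs) form a homogeneous Poisson point process of density $\lambda_t$ in $\mathbb R^2$; the user is at the origin. Each TX has, independently with probability $p$, an assisting reconfigurable surface (RIS) with $N$ elements at distance $d_0$. For a TX at distance $d$ from the user put $\eta_g=C_d d^{-\alpha}$ and $\eta_h=C_r(d_0 d)^{-\alpha}$ (the RIS-user distance is identified with the TX-user distance), and let $e_1=C_d+NC_rd_0^{-\alpha}$. Define $c=\frac{\Gamma(m_h+1/2)\Gamma(m_r+1/2)}{\Gamma(m_h)\Gamma(m_r)}(m_hm_r)^{-1/2}$, $M_1=Nc$, $M_2=N+N(N-1)c^2$, $\kappa_r=\frac{M_1^2}{M_2-M_1^2}$, $\omega_r=\frac{M_2-M_1^2}{M_1}$ (moments and fitted gamma parameters of $S_r=\sum_{n\le N}|h_n||r_n|$ for independent Nakagami variables $|h_n|,|r_n|$ of shapes $m_h,m_r$ and unit second moment), $\mu_q=\Gamma(1+\tfrac q2)$, $\nu_q=\omega_r^q\,\Gamma(q+\kappa_r)/\Gamma(\kappa_r)$,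 $\beta=\sqrt{C_rd_0^{-\alpha}/C_d}$, and $$\chi_1=\mu_2+2\beta\mu_1\nu_1+\beta^2\nu_2,\qquad \chi_2=\mu_4+4\beta\mu_3\nu_1+6\beta^2\mu_2\nu_2+4\beta^3\mu_1\nu_3+\beta^4\nu_4,$$ $$\kappa_s=\frac{\chi_1^2}{\chi_2-\chi_1^2},\qquad \bar\chi=\frac{\chi_2-\chi_1^2}{\chi_1},$$ and let $\hat\kappa_s$ be $\kappa_s$ rounded to the nearest positive integer. The user is served by the nearest TX. The serving TX at distance $d$ delivers a power $S$ which is gamma distributed with shape $\hat\kappa_s$ and scale $\eta_g\bar\chi$ if it has a RIS, and exponential with mean $\eta_g$ if not. Every other TX contributes to the interference $I$ an exponential power, of mean $\eta_g+N\eta_h$ if it has a RIS and $\eta_g$ if not. Given the locations and the presence of RISs, all powers are independent. The signal-to-interference-plus-noise ratio is $\gamma_0=S/(I+\gamma_t^{-1})$, where $\gamma_t$ is the transmit signal-to-noise ratio. Then for every threshold $\bar\gamma>0$ the coverage probability $\mathbb P(\gamma_0>\bar\gamma)$ converges as $\gamma_t\to\infty$ to $$\tilde P_{c,n}(\bar\gamma)=p\sum_{i=0}^{\hat\kappa_s-1}\frac{(-1)^i}{i!}\Big[\frac{\partial^i}{\partial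 s^i}Y_1(s)^{-1}\Big]_{s=1}+(1-p)\,Y_2^{-1},$$ and it is equal to this number when $\gamma_t^{-1}$ is replaced by $0$. Here $$Y_1(s)=p\,{}_2F_1\Big(1,-\tfrac2\alpha;1-\tfrac2\alpha;-\tfrac{e_1\bar\gamma}{C_d\bar\chi}s\Big)+(1-p)\,{}_2F_1\Big(1,-\tfrac2\alpha;1-\tfrac2\alpha;-\tfrac{\bar\gamma}{\bar\chi}s\Big),$$ $$Y_2=p\,{}_2F_1\Big(1,-\tfrac2\alpha;1-\tfrac2\alpha;-\tfrac{e_1\bar\gamma}{C_d}\Big)+(1-p)\,{}_2F_1\Big(1,-\tfrac2\alpha;1-\tfrac2\alpha;-\bar\gamma\Big),$$ where ${}_2F_1$ denotes the Gauss hypergeometric function, continued analytically to $(-\infty,1)$. In particular the expression does not involve the TX density $\lambda_t$. -/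

import Mathlib

open MeasureTheory ProbabilityTheory Filter Topology
open scoped ENNReal NNReal

/-! ### The Gauss hypergeometric function on `(-∞, 1)` -/

/-- `F` is the real-analytic continuation to `(-∞, 1)` of the Gauss hypergeometric series with
parameters `a, b; c`, which itself converges only on `(-1, 1)`. -/
def IsGaussHypergeometric (a b c : ℝ) (F : ℝ → ℝ) : Prop :=
  AnalyticOnNhd ℝ F (Set.Iio 1) ∧
    ∀ z ∈ Set.Ioo (-1 : ℝ) 1, F z = ordinaryHypergeometric a b c z

open Classical in
/-- The Gauss hypergeometric function of a real argument `z < 1`: the value at `z` of the analytic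
continuation of the hypergeometric series to `(-∞, 1)`. The continuation is unique on `(-∞, 1)` by
the identity theorem, and it exists whenever `c` is not a nonpositive integer. -/
noncomputable def gaussHypergeometric (a b c z : ℝ) : ℝ :=
  if h : ∃ F : ℝ → ℝ, IsGaussHypergeometric a b c F then h.choose z else 0

/-! ### System parameters and the moment-matching constants -/

/-- Parameters of the network other than the transmitter density and the noise level. -/
structure RISParams where
  /-- path loss exponent -/
  α : ℝ
  /-- path loss per unit distance of the direct link -/
  Cd : ℝ
  /-- path loss per unit distance of the reflected link -/
  Cr : ℝ
  /-- distance between a transmitter and its RIS -/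
  d0 : ℝ
  /-- probability that a transmitter has an assisting RIS -/
  p : unitInterval
  /-- number of elements of a RIS -/
  N : ℕ
  /-- Nakagami shape parameter of the transmitter-RIS channels -/
  mh : ℝ
  /-- Nakagami shape parameter of the RIS-user channels -/
  mr : ℝ

namespace RISParams

/-- The admissible ranges of the parameters. -/
structure Admissible (P : RISParams) : Prop where
  two_lt_α : 2 < P.α
  Cd_pos : 0 < P.Cd
  Cr_pos : 0 < P.Cr
  d0_pos : 0 < P.d0
  one_le_N : 1 ≤ P.N
  half_le_mh : 1 / 2 ≤ P.mh
  half_le_mr : 1 / 2 ≤ P.mr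

variable (P : RISParams)

/-- Path loss of the direct link of a transmitter at distance `d`. -/
noncomputable def etaG (d : ℝ) : ℝ := P.Cd * d ^ (-P.α)

/-- Path loss of the reflected link of a transmitter at distance `d`, where the distance from the
RIS to the user is identified with the distance from its transmitter to the user. -/
noncomputable def etaH (d : ℝ) : ℝ := P.Cr * (P.d0 * d) ^ (-P.α)

/-- `C_d + N C_r d_0^{-α}`. -/
noncomputable def e1 : ℝ := P.Cd + P.N * P.Cr * P.d0 ^ (-P.α)

/-- Mean of a product `|h| |r|` of independent Nakagami variables of shapes `mh`, `mr` and
unit second moments. -/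
noncomputable def meanHR : ℝ :=
  Real.Gamma (P.mh + 1 / 2) / Real.Gamma P.mh * (Real.Gamma (P.mr + 1 / 2) / Real.Gamma P.mr) *
    (1 / (P.mh * P.mr)) ^ (1 / 2 : ℝ)

/-- Mean of `S_r = ∑ |h_n| |r_n|` (`N` independent terms). -/
noncomputable def meanSr : ℝ := P.N * P.meanHR

/-- Second moment of `S_r`. -/
noncomputable def secondMomentSr : ℝ := P.N + P.N * (P.N - 1) * P.meanHR ^ 2

/-- Shape of the gamma law fitted to `S_r`. -/
noncomputable def kappaR : ℝ := P.meanSr ^ 2 / (P.secondMomentSr - P.meanSr ^ 2)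

/-- Scale of the gamma law fitted to `S_r`. -/
noncomputable def omegaR : ℝ := (P.secondMomentSr - P.meanSr ^ 2) / P.meanSr

/-- The moment of order `q` of the Rayleigh variable `|g_0|` with unit second moment. -/
noncomputable def muG (q : ℕ) : ℝ := Real.Gamma (1 + q / 2)

/-- The moment of order `q` of the gamma law fitted to `S_r`. -/
noncomputable def muS (q : ℕ) : ℝ :=
  P.omegaR ^ q * (Real.Gamma (q + P.kappaR) / Real.Gamma P.kappaR)

/-- `√(η_h / η_g)`, which does not depend on the distance of the transmitter. -/
noncomputable def beta : ℝ := √(P.Cr * P.d0 ^ (-P.α) / P.Cd)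

/-- `E[S_0⁺] / η_g`. -/
noncomputable def chi1 : ℝ := muG 2 + 2 * P.beta * muG 1 * P.muS 1 + P.beta ^ 2 * P.muS 2

/-- `E[(S_0⁺)²] / η_g²`. -/
noncomputable def chi2 : ℝ :=
  muG 4 + 4 * P.beta * muG 3 * P.muS 1 + 6 * P.beta ^ 2 * muG 2 * P.muS 2 +
    4 * P.beta ^ 3 * muG 1 * P.muS 3 + P.beta ^ 4 * P.muS 4

/-- Shape of the gamma law fitted to `S_0⁺`. -/
noncomputable def kappaS : ℝ := P.chi1 ^ 2 / (P.chi2 - P.chi1 ^ 2)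

/-- `κ_s` rounded to the nearest positive integer. -/
noncomputable def kappaHat : ℕ := max 1 (round P.kappaS).toNat

/-- Scale of the gamma law fitted to `S_0⁺ / η_g`. -/
noncomputable def chiBar : ℝ := (P.chi2 - P.chi1 ^ 2) / P.chi1

/-- The function `x ↦ ₂F₁(1, -2/α; 1 - 2/α; x)`. -/
noncomputable def hyp (x : ℝ) : ℝ := gaussHypergeometric 1 (-(2 / P.α)) (1 - 2 / P.α) x

/-- `Y_1(s)` at the threshold `T`. -/
noncomputable def Y1 (T s : ℝ) : ℝ :=
  P.p * P.hyp (-(P.e1 * T / (P.Cd * P.chiBar) * s)) +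
    (1 - P.p) * P.hyp (-(T / P.chiBar * s))

/-- `Y_2` at the threshold `T`. -/
noncomputable def Y2 (T : ℝ) : ℝ :=
  P.p * P.hyp (-(P.e1 * T / P.Cd)) + (1 - P.p) * P.hyp (-T)

/-- Law of the mark of a transmitter: the indicator of an assisting RIS; the power (in units of the
direct path loss) that it delivers as serving transmitter with a RIS, gamma distributed with shape
`κ̂_s` and scale `χ̄` (the second argument of `gammaMeasure` is the rate), and without a RIS;
and the normalized powers that it delivers as interferer, with and without a RIS. -/
noncomputable def markLaw : Measure (Bool × ℝ × ℝ × ℝ × ℝ) :=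
  (bernoulliMeasure true false P.p).prod
    ((gammaMeasure P.kappaHat (1 / P.chiBar)).prod
      ((expMeasure 1).prod ((expMeasure 1).prod (expMeasure 1))))

end RISParams

/-! ### The network -/

/-- The plane with its Euclidean norm. The typical user sits at the origin. -/
abbrev Plane := EuclideanSpace ℝ (Fin 2)

/-- The number of points of the sequence `X` in `B`. -/
noncomputable def pointCount {Ω : Type*} (X : ℕ → Ω → Plane) (B : Set Plane) (ω : Ω) : ℝ≥0∞ :=
  ∑' k, B.indicator (fun _ => (1 : ℝ≥0∞)) (X k ω)

/-- The random points `X 0, X 1, …`, listed in an arbitrary order, form a homogeneous Poisson point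
process of intensity `lam` on the plane. -/
structure IsPoissonProcess {Ω : Type*} [MeasurableSpace Ω] (μ : Measure Ω)
    (X : ℕ → Ω → Plane) (lam : ℝ) : Prop where
  measurable : ∀ k, Measurable (X k)
  law : ∀ B : Set Plane, MeasurableSet B → volume B ≠ ∞ →
    μ.map (pointCount X B) =
      (poissonMeasure (lam * volume.real B).toNNReal).map (fun n : ℕ => (n : ℝ≥0∞))
  indep : ∀ (n : ℕ) (B : Fin n → Set Plane), (∀ i, MeasurableSet (B i)) →
    Pairwise (Function.onFun Disjoint B) → iIndepFun (fun i => pointCount X (B i)) μ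

/-- The random elements of the network: for every transmitter `k` its location, the indicator `ris`
of an assisting RIS, and normalized signal and interference powers. -/
structure RISNetwork (Ω : Type*) where
  loc : ℕ → Ω → Plane
  ris : ℕ → Ω → Bool
  sigRIS : ℕ → Ω → ℝ
  sigDirect : ℕ → Ω → ℝ
  intRIS : ℕ → Ω → ℝ
  intDirect : ℕ → Ω → ℝ

namespace RISNetwork

variable {Ω : Type*} (net : RISNetwork Ω) (P : RISParams)

/-- The mark of transmitter `k`. -/
def mark (k : ℕ) (ω : Ω) : Bool × ℝ × ℝ × ℝ × ℝ :=
  (net.ris k ω, net.sigRIS k ω, net.sigDirect k ω, net.intRIS k ω, net.intDirect k ω)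

/-- The distance from transmitter `k` to the user. -/
noncomputable def dist (k : ℕ) (ω : Ω) : ℝ := ‖net.loc k ω‖

/-- The index of the transmitter that is nearest to the user (almost surely there is exactly one in
a Poisson process). -/
noncomputable def nearest (ω : Ω) : ℕ := sInf {k | ∀ j, net.dist k ω ≤ net.dist j ω}

/-- The power received from transmitter `k` when it serves the user. -/
noncomputable def signal (k : ℕ) (ω : Ω) : ℝ :=
  P.etaG (net.dist k ω) * (if net.ris k ω then net.sigRIS k ω else net.sigDirect k ω)

/-- The power received from transmitter `k` when it interferes: exponential with mean
`η_g + N η_h` if it has a RIS, and with mean `η_g` if it has none. -/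
noncomputable def interferer (k : ℕ) (ω : Ω) : ℝ :=
  if net.ris k ω then
    (P.etaG (net.dist k ω) + P.N * P.etaH (net.dist k ω)) * net.intRIS k ω
  else P.etaG (net.dist k ω) * net.intDirect k ω

/-- The aggregate interference when the user is served by transmitter `k`. -/
noncomputable def interference (k : ℕ) (ω : Ω) : ℝ≥0∞ :=
  ∑' j, if j = k then 0 else ENNReal.ofReal (net.interferer P j ω)

/-- The SINR of the user under nearest association, with normalized noise power `noise`, which is
`γ_t⁻¹` for the transmit SNR `γ_t`. -/
noncomputable def sinr (noise : ℝ) (ω : Ω) : ℝ≥0∞ :=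
  ENNReal.ofReal (net.signal P (net.nearest ω) ω) /
    (net.interference P (net.nearest ω) ω + ENNReal.ofReal noise)

/-- The coverage probability: the probability that the SINR exceeds the threshold `T`. -/
noncomputable def coverage [MeasurableSpace Ω] (μ : Measure Ω) (noise T : ℝ) : ℝ :=
  μ.real {ω | ENNReal.ofReal T < net.sinr P noise ω}

/-- The joint law of the network: the locations form a Poisson process of intensity `lam`, and
the marks are independent of each other and of the locations, with law `P.markLaw`. -/
structure HasLaw [MeasurableSpace Ω] (μ : Measure Ω) (lam : ℝ) : Prop where
  poisson : IsPoissonProcess μ net.loc lam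
  measurable_mark : ∀ k, Measurable (net.mark k)
  map_mark : ∀ k, μ.map (net.mark k) = P.markLaw
  indep_mark : iIndepFun net.mark μ
  indep_loc_mark : IndepFun (fun ω k => net.loc k ω) (fun ω k => net.mark k ω) μ

end RISNetwork

/-! After division by the direct path loss of the serving transmitter, coverage without noise says
that the normalized serving power exceeds `T * W`, where `W` is the interference ratio. The serving
index depends on the locations only, so the serving mark is independent of the other marks. Given
`W`, coverage has probability `p Q(T W / χ̄) + (1 - p) e^{-T W}`, where `Q(y) = ∑_{i < κ̂} y^i
e^{-y} / i!` is the tail of a gamma law of integer shape. With `Y = T W / χ̄`, the means `E[Y^i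
e^{-Y}]` are, up to sign, the derivatives at `s = 1` of `E[e^{-sY}]` (`lintegral_pow_mul_nexp`).
Only the Laplace transform of `W` remains to be found.

The map `x ↦ λπ‖x‖²` carries the locations to a unit Poisson process `U` on the half-line, and path
losses enter `W` only through ratios of distances; so `λ` disappears. Integrating the marks out
leaves `e^{-∑ H(U_j / U_k)}`, where `U_k` is the smallest point and `H` is minus the logarithm of
the mean factor of one interferer. Heuristically, given `U_k = r` the other points are Poisson on
`(r, ∞)` and contribute `e^{-rJ}` with `J = ∫_1^∞ (1 - e^{-H})`; since `r` is exponential, the mean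
is `∫ e^{-r} e^{-rJ} dr = 1 / (1 + J)` (`lintegral_ratioFactor`). The proof does not condition on
`U_k`. It locates `U_k` in a cell of a grid of mesh `h`, uses that `H` is antitone to bound the
factor on both sides, evaluates the bounds by the Laplace functional
(`IsPoissonWithIntensity.laplace`), sums two geometric series and lets `h → 0`.

Here `J` is a mixture of integrals `∫_1^∞ x / (u^{α/2} + x) du`, and `1` plus such an integral is
the hypergeometric function at `-x` (`gaussHypergeometric_neg_eq`). Hence `E[e^{-tW}]` is the
inverse of `RISParams.hypMixture` at `t`. Noise is removed by continuity of the measure along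
increasing events (`RISNetwork.tendsto_coverage`). -/

/-! ### The negative exponential on `[0, ∞]` -/

/-- The function `x ↦ e^{-x}` on `[0, ∞]`, with value `0` at `∞`. -/
noncomputable def nexp (x : ℝ≥0∞) : ℝ≥0∞ := EReal.exp (-(x : EReal))

lemma nexp_zero : nexp 0 = 1 := by simp [nexp]

lemma nexp_top : nexp ∞ = 0 := by simp [nexp]

lemma nexp_ofReal {x : ℝ} (hx : 0 ≤ x) :
    nexp (ENNReal.ofReal x) = ENNReal.ofReal (Real.exp (-x)) := by
  rw [nexp, EReal.coe_ennreal_ofReal, max_eq_left hx, ← EReal.coe_neg, EReal.exp_coe]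

lemma nexp_antitone : Antitone nexp := fun x y h => by
  unfold nexp
  rw [EReal.exp_le_exp_iff, EReal.neg_le_neg_iff]
  exact_mod_cast h

lemma nexp_le_one (x : ℝ≥0∞) : nexp x ≤ 1 := nexp_zero ▸ nexp_antitone zero_le

lemma nexp_ne_top (x : ℝ≥0∞) : nexp x ≠ ∞ := ((nexp_le_one x).trans_lt ENNReal.one_lt_top).ne

lemma nexp_add (x y : ℝ≥0∞) : nexp (x + y) = nexp x * nexp y := by
  unfold nexp
  rw [← EReal.exp_add, EReal.coe_ennreal_add, EReal.neg_add, sub_eq_add_neg]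
  · exact Or.inl (EReal.coe_ennreal_ne_bot x)
  · exact Or.inr (EReal.coe_ennreal_ne_bot y)

lemma continuous_nexp : Continuous nexp :=
  ENNReal.continuous_exp.comp (continuous_neg.comp continuous_coe_ennreal_ereal)

lemma measurable_nexp : Measurable nexp := continuous_nexp.measurable

lemma nexp_sum {ι : Type*} (s : Finset ι) (f : ι → ℝ≥0∞) :
    nexp (∑ i ∈ s, f i) = ∏ i ∈ s, nexp (f i) := by
  classical
  induction s using Finset.induction_on with
  | empty => simp [nexp_zero]
  | insert a s ha ih => rw [Finset.sum_insert ha, Finset.prod_insert ha, nexp_add, ih]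

lemma nexp_natCast_mul (n : ℕ) (x : ℝ≥0∞) : nexp (n * x) = nexp x ^ n := by
  rw [← nsmul_eq_mul, ← Finset.card_range n, ← Finset.sum_const, nexp_sum, Finset.prod_const,
    Finset.card_range]

lemma tendsto_nexp_sum_range (f : ℕ → ℝ≥0∞) :
    Tendsto (fun n => ∏ i ∈ Finset.range n, nexp (f i)) atTop (𝓝 (nexp (∑' i, f i))) := by
  simp_rw [← nexp_sum]
  exact (continuous_nexp.tendsto _).comp ENNReal.summable.hasSum.tendsto_sum_nat

/-- This is the generating function of the Poisson law at `b = e^{-c}`, summed by the exponential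
series. The value `c = ∞` is the case `b = 0`. -/
lemma lintegral_nexp_mul_poisson (r : ℝ≥0) (c : ℝ≥0∞) :
    ∫⁻ n : ℕ, nexp (c * n) ∂(poissonMeasure r) = nexp (r * (1 - nexp c)) := by
  obtain ⟨b, hb⟩ : ∃ b : ℝ, 0 ≤ b ∧ b ≤ 1 ∧ nexp c = ENNReal.ofReal b :=
    ⟨(nexp c).toReal, ENNReal.toReal_nonneg, ENNReal.toReal_le_of_le_ofReal zero_le_one
      (by simpa using nexp_le_one c), (ENNReal.ofReal_toReal (nexp_ne_top c)).symm⟩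
  obtain ⟨hb0, hb1, hb⟩ := hb
  rw [poissonMeasure, lintegral_sum_measure]
  simp_rw [lintegral_smul_measure, lintegral_dirac, mul_comm c, nexp_natCast_mul, hb, smul_eq_mul]
  have h1 : ∀ n : ℕ, ENNReal.ofReal (Real.exp (-r) * r ^ n / n.factorial) * ENNReal.ofReal b ^ n
      = ENNReal.ofReal (Real.exp (-r) * ((r * b) ^ n / n.factorial)) := by
    intro n
    rw [← ENNReal.ofReal_pow hb0, ← ENNReal.ofReal_mul (by positivity)]
    congr 1; rw [mul_pow]; ring
  simp_rw [h1]
  have hs : HasSum (fun n : ℕ => Real.exp (-r) * ((r * b) ^ n / n.factorial))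
      (Real.exp (-r) * Real.exp (r * b)) := by
    have := NormedSpace.expSeries_div_hasSum_exp ((r : ℝ) * b)
    rw [← Real.exp_eq_exp_ℝ] at this
    exact this.mul_left _
  rw [← ENNReal.ofReal_tsum_of_nonneg (fun n => by positivity) hs.summable, hs.tsum_eq,
    ← Real.exp_add]
  have h2 : (r : ℝ≥0∞) * (1 - ENNReal.ofReal b) = ENNReal.ofReal (r * (1 - b)) := by
    rw [ENNReal.ofReal_mul r.coe_nonneg, ENNReal.ofReal_sub _ hb0]; simp
  rw [h2, nexp_ofReal (mul_nonneg r.coe_nonneg (by linarith))]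
  congr 2; ring

/-! ### Poisson processes on measurable spaces -/

section PoissonProcess

variable {Ω E E' : Type*} [MeasurableSpace Ω] [MeasurableSpace E] [MeasurableSpace E']

/-- The number of points of the sequence `X` in `B`. -/
noncomputable def hitCount (X : ℕ → Ω → E) (B : Set E) (ω : Ω) : ℝ≥0∞ :=
  ∑' k, B.indicator (fun _ => (1 : ℝ≥0∞)) (X k ω)

/-- The random points `X 0, X 1, …` form a Poisson process with intensity measure `Λ`. -/
structure IsPoissonWithIntensity (μ : Measure Ω) (X : ℕ → Ω → E) (Λ : Measure E) : Prop where
  measurable : ∀ k, Measurable (X k)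
  law : ∀ B : Set E, MeasurableSet B → Λ B ≠ ∞ →
    μ.map (hitCount X B) = (poissonMeasure (Λ B).toNNReal).map (fun n : ℕ => (n : ℝ≥0∞))
  indep : ∀ (n : ℕ) (B : Fin n → Set E), (∀ i, MeasurableSet (B i)) →
    Pairwise (Function.onFun Disjoint B) → iIndepFun (fun i => hitCount X (B i)) μ

lemma IsPoissonProcess.isPoissonWithIntensity {μ : Measure Ω} {X : ℕ → Ω → Plane} {lam : ℝ}
    (hX : IsPoissonProcess μ X lam) (hlam : 0 < lam) :
    IsPoissonWithIntensity μ X (ENNReal.ofReal lam • volume) where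
  measurable := hX.measurable
  law B hB hfin := by
    have hv : volume B ≠ ∞ := by
      intro h
      apply hfin
      simp [h, hlam]
    refine (hX.law B hB hv).trans ?_
    congr 2
    rw [Measure.smul_apply, smul_eq_mul, ENNReal.toNNReal_mul, ENNReal.ofReal, ENNReal.toNNReal_coe,
      Real.toNNReal_mul hlam.le, Measure.real, ENNReal.toReal, Real.toNNReal_coe]
  indep := hX.indep

variable {μ : Measure Ω} {X : ℕ → Ω → E} {Λ : Measure E}

namespace IsPoissonWithIntensity

/-- The mapping theorem. -/
lemma map (hX : IsPoissonWithIntensity μ X Λ) {f : E → E'} (hf : Measurable f) :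
    IsPoissonWithIntensity μ (fun k ω => f (X k ω)) (Λ.map f) where
  measurable k := hf.comp (hX.measurable k)
  law B hB hfin := by
    rw [Measure.map_apply hf hB] at hfin ⊢
    exact hX.law (f ⁻¹' B) (hf hB) hfin
  indep n B hB hd := hX.indep n (fun i => f ⁻¹' (B i)) (fun i => hf (hB i))
    fun i j hij => (hd hij).preimage f

lemma measurable_hitCount (hX : IsPoissonWithIntensity μ X Λ) {B : Set E} (hB : MeasurableSet B) :
    Measurable (hitCount X B) :=
  Measurable.tsum fun k => (measurable_const.indicator hB).comp (hX.measurable k)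

lemma lintegral_hitCount (hX : IsPoissonWithIntensity μ X Λ) {B : Set E} (hB : MeasurableSet B)
    (hfin : Λ B ≠ ∞) {f : ℝ≥0∞ → ℝ≥0∞} (hf : Measurable f) :
    ∫⁻ ω, f (hitCount X B ω) ∂μ = ∫⁻ n : ℕ, f n ∂(poissonMeasure (Λ B).toNNReal) := by
  rw [← lintegral_map hf (hX.measurable_hitCount hB), hX.law B hB hfin,
    lintegral_map hf (measurable_of_countable _)]

lemma ae_hitCount_lt_top (hX : IsPoissonWithIntensity μ X Λ) {B : Set E} (hB : MeasurableSet B)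
    (hfin : Λ B ≠ ∞) : ∀ᵐ ω ∂μ, hitCount X B ω < ∞ := by
  have h : ∀ᵐ x ∂(μ.map (hitCount X B)), x < ∞ := by
    rw [hX.law B hB hfin,
      ae_map_iff (measurable_of_countable _).aemeasurable measurableSet_Iio]
    exact ae_of_all _ fun n => ENNReal.natCast_lt_top n
  exact ae_of_ae_map (hX.measurable_hitCount hB).aemeasurable h

lemma measure_hitCount_eq (hX : IsPoissonWithIntensity μ X Λ) {B : Set E} (hB : MeasurableSet B)
    (hfin : Λ B ≠ ∞) (n : ℕ) :
    μ (hitCount X B ⁻¹' {(n : ℝ≥0∞)}) =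
      ENNReal.ofReal (Real.exp (-(Λ B).toReal) * (Λ B).toReal ^ n / n.factorial) := by
  rw [← Measure.map_apply (hX.measurable_hitCount hB) (measurableSet_singleton _),
    hX.law B hB hfin, Measure.map_apply (measurable_of_countable _) (measurableSet_singleton _)]
  have h2 : (fun n : ℕ => (n : ℝ≥0∞)) ⁻¹' {(n : ℝ≥0∞)} = {n} := by
    ext m; simp
  rw [h2, poissonMeasure_singleton]
  rfl

lemma iIndepFun_hitCount (hX : IsPoissonWithIntensity μ X Λ) {ι : Type*} [Fintype ι]
    {B : ι → Set E} (hB : ∀ i, MeasurableSet (B i)) (hd : Pairwise (Function.onFun Disjoint B)) :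
    iIndepFun (fun i => hitCount X (B i)) μ := by
  have e := Fintype.equivFin ι
  have := hX.indep _ (fun i => B (e.symm i)) (fun i => hB _)
    fun i j hij => hd (e.symm.injective.ne hij)
  have h := this.precomp e.injective
  simpa using h

/-- Reduces a sum over the points to finitely many counts. The level `0` is left out because its
fibre may have infinite intensity, where the law of the count is not given. -/
lemma tsum_simpleFunc_eq (G : SimpleFunc E ℝ≥0∞) (x : ℕ → E) :
    ∑' k, G (x k) = ∑ c : G.range.erase 0, (c : ℝ≥0∞) *
      ∑' k, (G ⁻¹' {(c : ℝ≥0∞)}).indicator (fun _ => (1 : ℝ≥0∞)) (x k) := by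
  have h : ∀ y, G y = ∑ c : G.range.erase 0, (c : ℝ≥0∞) *
      (G ⁻¹' {(c : ℝ≥0∞)}).indicator (fun _ => (1 : ℝ≥0∞)) y := by
    intro y
    rw [Finset.sum_coe_sort (G.range.erase 0)
      (fun c => c * (G ⁻¹' {c}).indicator (fun _ => (1 : ℝ≥0∞)) y)]
    by_cases h0 : G y = 0
    · rw [Finset.sum_eq_zero, h0]
      intro c hc
      have : y ∉ G ⁻¹' {c} := by
        intro hy
        exact (Finset.mem_erase.1 hc).1 (by rw [← h0]; exact (Set.mem_singleton_iff.1 hy).symm)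
      simp [this]
    · rw [Finset.sum_eq_single_of_mem (G y) (Finset.mem_erase.2 ⟨h0, G.mem_range_self y⟩)]
      · simp
      · intro c _ hc
        have : y ∉ G ⁻¹' {c} := fun hy => hc (Set.mem_singleton_iff.1 hy).symm
        simp [this]
  simp_rw [← ENNReal.tsum_mul_left]
  rw [← Summable.tsum_finsetSum (fun _ _ => ENNReal.summable)]
  exact tsum_congr fun k => h _

/-- The sets `A i` and the nonzero level sets of `G` are pairwise disjoint because `G` vanishes on
each `A i`. All counts are therefore independent, and each level set contributes a Poisson
generating function. -/
lemma laplace_simpleFunc (hX : IsPoissonWithIntensity μ X Λ) {ι : Type*} [Fintype ι]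
    {A : ι → Set E} (hA : ∀ i, MeasurableSet (A i)) (hd : Pairwise (Function.onFun Disjoint A))
    {F : ι → ℝ≥0∞ → ℝ≥0∞} (hF : ∀ i, Measurable (F i)) (G : SimpleFunc E ℝ≥0∞)
    (hfin : Λ (Function.support G) ≠ ∞) (hGA : ∀ i, ∀ x ∈ A i, G x = 0) :
    ∫⁻ ω, (∏ i, F i (hitCount X (A i) ω)) * nexp (∑' k, G (X k ω)) ∂μ =
      (∏ i, ∫⁻ ω, F i (hitCount X (A i) ω) ∂μ) * nexp (∫⁻ x, (1 - nexp (G x)) ∂Λ) := by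
  let B : ι ⊕ (G.range.erase 0) → Set E := Sum.elim A (fun c => G ⁻¹' {(c : ℝ≥0∞)})
  let Φ : ι ⊕ (G.range.erase 0) → ℝ≥0∞ → ℝ≥0∞ :=
    Sum.elim F (fun c n => nexp (c * n))
  have hc0 : ∀ c : (G.range.erase 0), (c : ℝ≥0∞) ≠ 0 := fun c => (Finset.mem_erase.1 c.2).1
  have hBm : ∀ j, MeasurableSet (B j) := by
    rintro (i | c)
    · exact hA i
    · exact G.measurableSet_fiber _
  have hBd : Pairwise (Function.onFun Disjoint B) := by
    rintro (i | c) (j | c') hij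
    · exact hd (fun h => hij (by rw [h]))
    · refine Set.disjoint_left.2 fun x hx hx' => hc0 c' ?_
      rw [← Set.mem_singleton_iff.1 hx', hGA i x hx]
    · refine Set.disjoint_left.2 fun x hx' hx => hc0 c ?_
      rw [← Set.mem_singleton_iff.1 hx', hGA j x hx]
    · refine Set.disjoint_left.2 fun x hx hx' => hij ?_
      congr 1
      exact Subtype.ext ((Set.mem_singleton_iff.1 hx).symm.trans (Set.mem_singleton_iff.1 hx'))
  have hΦ : ∀ j, Measurable (Φ j) := by
    rintro (i | c)
    · exact hF i
    · exact measurable_nexp.comp (measurable_id.const_mul _)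
  have hind := (hX.iIndepFun_hitCount hBm hBd).comp Φ hΦ
  have key := lintegral_prod_eq_prod_lintegral_of_indepFun Finset.univ _ hind
    (fun j => (hΦ j).comp (hX.measurable_hitCount (hBm j)))
  rw [Fintype.prod_sum_type] at key
  have hl : ∀ ω, ∏ j, (Φ j ∘ hitCount X (B j)) ω =
      (∏ i, F i (hitCount X (A i) ω)) * nexp (∑' k, G (X k ω)) := by
    intro ω
    rw [Fintype.prod_sum_type, tsum_simpleFunc_eq, nexp_sum]
    rfl
  simp_rw [hl] at key
  rw [key]
  congr 1
  have h1 : ∫⁻ x, (1 - nexp (G x)) ∂Λ =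
      ∑ c : G.range.erase 0, (1 - nexp (c : ℝ≥0∞)) * Λ (G ⁻¹' {(c : ℝ≥0∞)}) := by
    have := SimpleFunc.lintegral_eq_lintegral (G.map fun c => 1 - nexp c) Λ
    rw [SimpleFunc.map_lintegral] at this
    rw [Finset.sum_coe_sort (G.range.erase 0) (fun c => (1 - nexp c) * Λ (G ⁻¹' {c})),
      Finset.sum_erase _ (by simp [nexp_zero]), ← this]
    rfl
  rw [h1, nexp_sum]
  refine Finset.prod_congr rfl fun c _ => ?_
  have hfc : Λ (G ⁻¹' {(c : ℝ≥0∞)}) ≠ ∞ := by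
    refine ne_top_of_le_ne_top hfin (measure_mono fun x hx => ?_)
    rw [Function.mem_support, Set.mem_singleton_iff.1 hx]
    exact hc0 c
  change ∫⁻ ω, nexp (c * hitCount X (G ⁻¹' {(c : ℝ≥0∞)}) ω) ∂μ = _
  rw [hX.lintegral_hitCount (G.measurableSet_fiber _) hfc
    (f := fun n => nexp (c * n)) (measurable_nexp.comp (measurable_id.const_mul _)),
    lintegral_nexp_mul_poisson, ENNReal.coe_toNNReal hfc, mul_comm]

/-- The Laplace functional of a Poisson process, jointly with functions of the numbers of points in
sets on which the test function vanishes. -/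
lemma laplace [SigmaFinite Λ] [IsProbabilityMeasure μ] (hX : IsPoissonWithIntensity μ X Λ)
    {ι : Type*} [Fintype ι]
    {A : ι → Set E} (hA : ∀ i, MeasurableSet (A i)) (hd : Pairwise (Function.onFun Disjoint A))
    {F : ι → ℝ≥0∞ → ℝ≥0∞} (hF : ∀ i, Measurable (F i)) (hF1 : ∀ i x, F i x ≤ 1)
    {G : E → ℝ≥0∞} (hG : Measurable G) (hGA : ∀ i, ∀ x ∈ A i, G x = 0) :
    ∫⁻ ω, (∏ i, F i (hitCount X (A i) ω)) * nexp (∑' k, G (X k ω)) ∂μ =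
      (∏ i, ∫⁻ ω, F i (hitCount X (A i) ω) ∂μ) * nexp (∫⁻ x, (1 - nexp (G x)) ∂Λ) := by
  let S := spanningSets Λ
  have hS : ∀ n, MeasurableSet (S n) := measurableSet_spanningSets Λ
  -- Cutting to the spanning sets gives supports of finite intensity and keeps the monotone
  -- convergence to `G`.
  let g : ℕ → SimpleFunc E ℝ≥0∞ := fun n => (SimpleFunc.eapprox G n).restrict (S n)
  have hg : ∀ n x, g n x = (S n).indicator (SimpleFunc.eapprox G n) x :=
    fun n x => SimpleFunc.restrict_apply _ (hS n) x
  have hmono : ∀ x, Monotone fun n => g n x := by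
    intro x m n hmn
    simp only [hg]
    by_cases hx : x ∈ S m
    · rw [Set.indicator_of_mem hx, Set.indicator_of_mem (monotone_spanningSets Λ hmn hx)]
      exact SimpleFunc.monotone_eapprox G hmn x
    · rw [Set.indicator_of_notMem hx]; exact zero_le
  have hle : ∀ n x, g n x ≤ G x := by
    intro n x
    rw [hg]
    refine (Set.indicator_le_self _ _ x).trans ?_
    rw [← SimpleFunc.iSup_eapprox_apply hG x]
    exact le_iSup (fun n => SimpleFunc.eapprox G n x) n
  have hlim : ∀ x, Tendsto (fun n => g n x) atTop (𝓝 (G x)) := by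
    intro x
    refine (SimpleFunc.tendsto_eapprox hG x).congr' ?_
    filter_upwards [eventually_ge_atTop (spanningSetsIndex Λ x)] with n hn
    rw [hg, Set.indicator_of_mem]
    exact monotone_spanningSets Λ hn (mem_spanningSetsIndex Λ x)
  have hfin : ∀ n, Λ (Function.support (g n)) ≠ ∞ := by
    intro n
    refine ne_top_of_le_ne_top (measure_spanningSets_lt_top Λ n).ne (measure_mono fun x hx => ?_)
    by_contra h
    exact hx (by rw [hg, Set.indicator_of_notMem h])
  have hgA : ∀ n, ∀ i, ∀ x ∈ A i, g n x = 0 := fun n i x hx =>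
    le_antisymm ((hle n x).trans (hGA i x hx).le) zero_le
  have key := fun n => hX.laplace_simpleFunc hA hd hF (g n) (hfin n) (hgA n)
  have hgm : ∀ n, Measurable (g n) := fun n => (g n).measurable
  have hsum : ∀ ω, Tendsto (fun n => ∑' k, g n (X k ω)) atTop (𝓝 (∑' k, G (X k ω))) := by
    intro ω
    -- Monotone convergence for the sum over the points, read as an integral against counting
    -- measure.
    have h := lintegral_tendsto_of_tendsto_of_monotone (μ := Measure.count)
      (f := fun n k => g n (X k ω)) (F := fun k => G (X k ω))
      (fun n => (measurable_of_countable _).aemeasurable) (ae_of_all _ fun k => hmono _)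
      (ae_of_all _ fun k => hlim _)
    simpa only [lintegral_count] using h
  have hint : Tendsto (fun n => ∫⁻ x, (1 - nexp (g n x)) ∂Λ) atTop
      (𝓝 (∫⁻ x, (1 - nexp (G x)) ∂Λ)) := by
    refine lintegral_tendsto_of_tendsto_of_monotone
      (fun n => ((measurable_nexp.comp (hgm n)).const_sub 1).aemeasurable)
      (ae_of_all _ fun x m n hmn => tsub_le_tsub_left (nexp_antitone (hmono x hmn)) 1)
      (ae_of_all _ fun x => ?_)
    exact ENNReal.Tendsto.sub tendsto_const_nhds ((continuous_nexp.tendsto _).comp (hlim x))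
      (Or.inl ENNReal.one_ne_top)
  have hPm : Measurable fun ω => ∏ i, F i (hitCount X (A i) ω) :=
    Finset.measurable_prod _ fun i _ => (hF i).comp (hX.measurable_hitCount (hA i))
  have hP1 : ∀ ω, ∏ i, F i (hitCount X (A i) ω) ≤ 1 := fun ω =>
    Finset.prod_le_one' fun i _ => hF1 i _
  have hL : Tendsto (fun n => ∫⁻ ω, (∏ i, F i (hitCount X (A i) ω)) *
      nexp (∑' k, g n (X k ω)) ∂μ) atTop
      (𝓝 (∫⁻ ω, (∏ i, F i (hitCount X (A i) ω)) * nexp (∑' k, G (X k ω)) ∂μ)) := by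
    refine tendsto_lintegral_of_dominated_convergence (fun _ => 1) (fun n => ?_) (fun n => ?_)
      (by simp) (ae_of_all _ fun ω => ?_)
    · exact hPm.mul (measurable_nexp.comp
        (Measurable.tsum fun k => (hgm n).comp (hX.measurable k)))
    · exact ae_of_all _ fun ω => mul_le_one' (hP1 ω) (nexp_le_one _)
    · exact ENNReal.Tendsto.const_mul ((continuous_nexp.tendsto _).comp (hsum ω))
        (Or.inr ((hP1 ω).trans_lt ENNReal.one_lt_top).ne)
  have hR : Tendsto (fun n => (∏ i, ∫⁻ ω, F i (hitCount X (A i) ω) ∂μ) *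
      nexp (∫⁻ x, (1 - nexp (g n x)) ∂Λ)) atTop
      (𝓝 ((∏ i, ∫⁻ ω, F i (hitCount X (A i) ω) ∂μ) * nexp (∫⁻ x, (1 - nexp (G x)) ∂Λ))) := by
    refine ENNReal.Tendsto.const_mul ((continuous_nexp.tendsto _).comp hint)
      (Or.inr (ENNReal.prod_ne_top fun i _ => ?_))
    refine ne_top_of_le_ne_top ENNReal.one_ne_top ?_
    calc ∫⁻ ω, F i (hitCount X (A i) ω) ∂μ ≤ ∫⁻ _, 1 ∂μ := lintegral_mono fun ω => hF1 i _
      _ = 1 := by simp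
  simp_rw [key] at hL
  exact tendsto_nhds_unique hL hR

end IsPoissonWithIntensity

end PoissonProcess

/-! ### The nearest point of a Poisson process on the half-line -/

section NearestPoint

/-- The smallest index at which the sequence `u` attains its minimum. -/
noncomputable def argminIndex (u : ℕ → ℝ) : ℕ := sInf {k | ∀ j, u k ≤ u j}

/-- A sequence need not attain its infimum, and then `argminIndex` is the default `0`. Finiteness
below a level that some term undercuts forces a minimizer. -/
lemma le_of_finite_lt {u : ℕ → ℝ} {b : ℝ} (hfin : {k | u k < b}.Finite) {i : ℕ} (hi : u i < b)
    (j : ℕ) : u (argminIndex u) ≤ u j := by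
  obtain ⟨k, hk, hmin⟩ := Set.exists_min_image _ u hfin ⟨i, hi⟩
  have hmem : k ∈ {k | ∀ j, u k ≤ u j} := by
    intro j
    rcases lt_or_ge (u j) b with h | h
    · exact hmin j h
    · exact (le_of_lt hk).trans h
  exact Nat.sInf_mem ⟨k, hmem⟩ j

lemma argminIndex_eq_of_lt {u : ℕ → ℝ} {k : ℕ} (h : ∀ j, j ≠ k → u k < u j) :
    argminIndex u = k := by
  have hs : {k | ∀ j, u k ≤ u j} = {k} := by
    ext i
    simp only [Set.mem_ofPred_eq, Set.mem_singleton_iff]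
    constructor
    · intro hi
      by_contra hne
      exact absurd (hi k) (not_le.2 (h i hne))
    · rintro rfl j
      by_cases hj : j = i
      · rw [hj]
      · exact (h j hj).le
  rw [argminIndex, hs]
  exact csInf_singleton k

variable {Ω E : Type*}

lemma hitCount_eq_count (X : ℕ → Ω → E) (B : Set E) (ω : Ω) :
    hitCount X B ω = Measure.count {k | X k ω ∈ B} := by
  rw [← lintegral_indicator_one (MeasurableSet.of_discrete), lintegral_count]
  rfl

lemma hitCount_eq_zero_iff {X : ℕ → Ω → E} {B : Set E} {ω : Ω} :
    hitCount X B ω = 0 ↔ ∀ k, X k ω ∉ B := by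
  rw [hitCount_eq_count, Measure.count_eq_zero_iff, Set.eq_empty_iff_forall_notMem]
  rfl

lemma finite_of_hitCount_lt_top {X : ℕ → Ω → E} {B : Set E} {ω : Ω}
    (h : hitCount X B ω < ∞) : {k | X k ω ∈ B}.Finite := by
  rwa [hitCount_eq_count, Measure.count_apply_lt_top] at h

lemma exists_of_hitCount_eq_one {X : ℕ → Ω → E} {B : Set E} {ω : Ω}
    (h : hitCount X B ω = 1) : ∃ k, ∀ j, X j ω ∈ B ↔ j = k := by
  rw [hitCount_eq_count, Measure.count_apply MeasurableSet.of_discrete] at h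
  have h' : {k | X k ω ∈ B}.encard = 1 := by exact_mod_cast h
  obtain ⟨k, hk⟩ := Set.encard_eq_one.1 h'
  exact ⟨k, fun j => by rw [← Set.mem_singleton_iff, ← hk]; rfl⟩

/-- The factor `e^{-∑ H(u_j / u_k)}` of the points other than the smallest one. -/
noncomputable def ratioFactor (H : ℝ → ℝ≥0∞) (u : ℕ → ℝ) : ℝ≥0∞ :=
  nexp (∑' j, if j = argminIndex u then 0 else H (u j / u (argminIndex u)))

lemma ratioFactor_le_one (H : ℝ → ℝ≥0∞) (u : ℕ → ℝ) : ratioFactor H u ≤ 1 := nexp_le_one _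

variable [MeasurableSpace Ω] {μ : Measure Ω} [IsProbabilityMeasure μ] {U : ℕ → Ω → ℝ}
  {H : ℝ → ℝ≥0∞}

lemma volume_restrict_Iio (a : ℝ) :
    (volume.restrict (Set.Ici (0 : ℝ))) (Set.Iio a) = ENNReal.ofReal a := by
  rw [Measure.restrict_apply measurableSet_Iio, Set.inter_comm, Set.Ici_inter_Iio,
    Real.volume_Ico, sub_zero]

lemma volume_restrict_Ico {a b : ℝ} (ha : 0 ≤ a) :
    (volume.restrict (Set.Ici (0 : ℝ))) (Set.Ico a b) = ENNReal.ofReal (b - a) := by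
  rw [Measure.restrict_apply measurableSet_Ico, Set.inter_eq_left.2, Real.volume_Ico]
  exact fun x hx => ha.trans hx.1

lemma measurable_tail (hHm : Measurable H) (c b : ℝ) :
    Measurable ((Set.Ici b).indicator fun u => H (u / c)) :=
  (hHm.comp (measurable_id.div_const c)).indicator measurableSet_Ici

/-- Substitution `v = u / c`. The restriction to the half-line is harmless because the integrand
vanishes below `b ≥ 0`. -/
lemma lintegral_tail (hHm : Measurable H) (c : ℝ) {b : ℝ} (hc : 0 < c) (hb : 0 ≤ b) :
    ∫⁻ x in Set.Ici 0, (1 - nexp ((Set.Ici b).indicator (fun u => H (u / c)) x)) =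
      ENNReal.ofReal c * ∫⁻ v in Set.Ici (b / c), (1 - nexp (H v)) := by
  have h1 : ∀ x, 1 - nexp ((Set.Ici b).indicator (fun u => H (u / c)) x) =
      (Set.Ici (b / c)).indicator (fun v => 1 - nexp (H v)) (c⁻¹ * x) := by
    intro x
    by_cases hx : x ∈ Set.Ici b
    · have hx' : c⁻¹ * x ∈ Set.Ici (b / c) := by
        rw [Set.mem_Ici, div_eq_inv_mul]
        exact mul_le_mul_of_nonneg_left hx (inv_nonneg.2 hc.le)
      rw [Set.indicator_of_mem hx, Set.indicator_of_mem hx', div_eq_inv_mul]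
    · have hx' : c⁻¹ * x ∉ Set.Ici (b / c) := by
        rw [Set.mem_Ici, div_eq_inv_mul]
        exact fun h => hx (le_of_mul_le_mul_left h (inv_pos.2 hc))
      rw [Set.indicator_of_notMem hx, Set.indicator_of_notMem hx', nexp_zero, tsub_self]
  have h2 : ∫⁻ x in Set.Ici 0, (1 - nexp ((Set.Ici b).indicator (fun u => H (u / c)) x)) =
      ∫⁻ x, (1 - nexp ((Set.Ici b).indicator (fun u => H (u / c)) x)) := by
    refine setLIntegral_eq_of_support_subset ?_
    intro x hx
    by_contra h
    refine hx ?_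
    have : x ∉ Set.Ici b := fun h' => h (hb.trans h')
    simp [this, nexp_zero]
  rw [h2]
  simp_rw [h1]
  have hm : Measurable ((Set.Ici (b / c)).indicator (fun v => 1 - nexp (H v))) :=
    ((measurable_nexp.comp hHm).const_sub 1).indicator measurableSet_Ici
  rw [← lintegral_map hm (measurable_const_mul c⁻¹),
    Real.map_volume_mul_left (inv_ne_zero hc.ne'), lintegral_smul_measure, inv_inv,
    abs_of_pos hc, lintegral_indicator measurableSet_Ici, smul_eq_mul]

/-- The Laplace functional for the three disjoint zones below `a`, in `[a, b)` and from `b` on. The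
factor `e^{-a}` is the probability that the first zone is empty; `F` is left free for the two cell
events used below. -/
lemma lintegral_mul_nexp_tail (hU : IsPoissonWithIntensity μ U (volume.restrict (Set.Ici 0)))
    (hHm : Measurable H) {a b c : ℝ} (ha : 0 < a) (hab : a < b) (hc : 0 < c) {F : ℝ≥0∞ → ℝ≥0∞}
    (hF : Measurable F) (hF1 : ∀ x, F x ≤ 1) :
    ∫⁻ ω, (({0} : Set ℝ≥0∞).indicator 1 (hitCount U (Set.Iio a) ω) *
        F (hitCount U (Set.Ico a b) ω)) *
        nexp (∑' k, (Set.Ici b).indicator (fun u => H (u / c)) (U k ω)) ∂μ =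
      ENNReal.ofReal (Real.exp (-a)) * (∫⁻ ω, F (hitCount U (Set.Ico a b) ω) ∂μ) *
        nexp (ENNReal.ofReal c * ∫⁻ v in Set.Ici (b / c), (1 - nexp (H v))) := by
  have h0m : Measurable (({0} : Set ℝ≥0∞).indicator (1 : ℝ≥0∞ → ℝ≥0∞)) :=
    measurable_one.indicator (measurableSet_singleton _)
  have key := hU.laplace (A := ![Set.Iio a, Set.Ico a b])
    (F := ![({0} : Set ℝ≥0∞).indicator 1, F]) (G := (Set.Ici b).indicator fun u => H (u / c))
    (by
      intro i; fin_cases i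
      · exact measurableSet_Iio
      · exact measurableSet_Ico)
    (by
      have hd : Disjoint (Set.Iio a) (Set.Ico a b) :=
        Set.disjoint_left.2 fun x hx hx' => not_le.2 hx hx'.1
      intro i j hij
      fin_cases i <;> fin_cases j
      · exact absurd rfl hij
      · exact hd
      · exact hd.symm
      · exact absurd rfl hij)
    (by
      intro i; fin_cases i
      · exact h0m
      · exact hF)
    (by
      intro i x; fin_cases i
      · exact Set.indicator_le_self' (fun _ _ => zero_le) x
      · exact hF1 x)
    (measurable_tail hHm c b)
    (by
      intro i x hx
      refine Set.indicator_of_notMem (fun h : b ≤ x => ?_) _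
      fin_cases i
      · exact absurd (hab.trans_le h) (not_lt.2 (le_of_lt hx))
      · exact absurd h (not_le.2 hx.2))
  simp only [Fin.prod_univ_two, Matrix.cons_val_zero, Matrix.cons_val_one] at key
  rw [key, lintegral_tail hHm c hc (ha.trans hab).le]
  congr 2
  have h1 : (fun ω => ({0} : Set ℝ≥0∞).indicator (1 : ℝ≥0∞ → ℝ≥0∞) (hitCount U (Set.Iio a) ω)) =
      (hitCount U (Set.Iio a) ⁻¹' {0}).indicator 1 := rfl
  have h2 := hU.measure_hitCount_eq (B := Set.Iio a) measurableSet_Iio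
    (by rw [volume_restrict_Iio a]; exact ENNReal.ofReal_ne_top) 0
  rw [volume_restrict_Iio a, ENNReal.toReal_ofReal ha.le] at h2
  rw [h1, lintegral_indicator_one (hU.measurable_hitCount measurableSet_Iio
    (measurableSet_singleton 0))]
  simpa using h2

/-- On this event the smallest point lies in `[a, b)`. Replacing it by `a` enlarges the ratios and
so lowers `H`; discarding the other points of the cell lowers the sum further. Both changes increase
the factor. -/
lemma setLIntegral_ratioFactor_le (hU : IsPoissonWithIntensity μ U (volume.restrict (Set.Ici 0)))
    (hHm : Measurable H) (hH : AntitoneOn H (Set.Ioi 0)) {a b : ℝ} (ha : 0 < a) (hab : a < b) :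
    ∫⁻ ω in {ω | hitCount U (Set.Iio a) ω = 0 ∧ hitCount U (Set.Ico a b) ω ≠ 0},
        ratioFactor H (fun j => U j ω) ∂μ ≤
      ENNReal.ofReal (Real.exp (-a)) * ENNReal.ofReal (1 - Real.exp (-(b - a))) *
        nexp (ENNReal.ofReal a * ∫⁻ v in Set.Ici (b / a), (1 - nexp (H v))) := by
  have h0m : Measurable ((({0} : Set ℝ≥0∞)ᶜ).indicator (1 : ℝ≥0∞ → ℝ≥0∞)) :=
    measurable_one.indicator (measurableSet_singleton _).compl
  have key := lintegral_mul_nexp_tail hU hHm ha hab ha h0m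
    (Set.indicator_le_self' (fun _ _ => zero_le))
  have hI : MeasurableSet (hitCount U (Set.Ico a b) ⁻¹' {0}) :=
    hU.measurable_hitCount measurableSet_Ico (measurableSet_singleton 0)
  have h1 : ∫⁻ ω, (({0} : Set ℝ≥0∞)ᶜ).indicator (1 : ℝ≥0∞ → ℝ≥0∞)
      (hitCount U (Set.Ico a b) ω) ∂μ = ENNReal.ofReal (1 - Real.exp (-(b - a))) := by
    have h1' : (fun ω => (({0} : Set ℝ≥0∞)ᶜ).indicator (1 : ℝ≥0∞ → ℝ≥0∞)
        (hitCount U (Set.Ico a b) ω)) = ((hitCount U (Set.Ico a b) ⁻¹' {0})ᶜ).indicator 1 := rfl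
    rw [h1', lintegral_indicator_one hI.compl, prob_compl_eq_one_sub hI]
    have h2 := hU.measure_hitCount_eq (B := Set.Ico a b) measurableSet_Ico
      (by rw [volume_restrict_Ico ha.le]; exact ENNReal.ofReal_ne_top) 0
    rw [volume_restrict_Ico ha.le, ENNReal.toReal_ofReal (by linarith)] at h2
    rw [ENNReal.ofReal_sub _ (Real.exp_pos _).le, ENNReal.ofReal_one]
    congr 1
    simpa using h2
  rw [h1] at key
  rw [← key, ← lintegral_indicator (by
    exact ((hU.measurable_hitCount measurableSet_Iio (measurableSet_singleton 0)).inter hI.compl))]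
  have hfin := hU.ae_hitCount_lt_top (B := Set.Iio b) measurableSet_Iio
    (by rw [volume_restrict_Iio b]; exact ENNReal.ofReal_ne_top)
  refine lintegral_mono_ae ?_
  filter_upwards [hfin] with ω hω
  by_cases hE : hitCount U (Set.Iio a) ω = 0 ∧ hitCount U (Set.Ico a b) ω ≠ 0
  swap
  · rw [Set.indicator_of_notMem (by exact hE)]; exact zero_le
  rw [Set.indicator_of_mem (by exact hE), Set.indicator_of_mem (s := {0}) (by exact hE.1),
    Set.indicator_of_mem (by exact hE.2), Pi.one_apply, Pi.one_apply, one_mul, one_mul]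
  obtain ⟨h0, hne⟩ := hE
  rw [hitCount_eq_zero_iff] at h0
  rw [Ne, hitCount_eq_zero_iff, not_forall] at hne
  obtain ⟨i, hi⟩ := hne
  rw [not_not] at hi
  have hmin := le_of_finite_lt (u := fun j => U j ω) (finite_of_hitCount_lt_top hω) hi.2
  have hk0 := h0 (argminIndex fun j => U j ω)
  have hkb := (hmin i).trans_lt hi.2
  rw [ratioFactor]
  set k := argminIndex fun j => U j ω
  have hka : a ≤ U k ω := not_lt.1 hk0
  refine nexp_antitone (ENNReal.tsum_le_tsum fun j => ?_)
  by_cases hj : b ≤ U j ω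
  · have hjk : j ≠ k := by
      rintro rfl
      exact absurd hkb (not_lt.2 hj)
    rw [if_neg hjk, Set.indicator_of_mem (by exact hj)]
    have hj0 : 0 < U j ω := (ha.trans hab).trans_le hj
    exact hH (div_pos hj0 (ha.trans_le hka)) (div_pos hj0 ha)
      (div_le_div_of_nonneg_left hj0.le ha hka)
  · rw [Set.indicator_of_notMem (by exact hj)]; exact zero_le

/-- With exactly one point in the cell, that point is the smallest and all others are at least `b`.
Replacing it by `b` lowers the ratios, raises `H` and decreases the factor. -/
lemma le_setLIntegral_ratioFactor (hU : IsPoissonWithIntensity μ U (volume.restrict (Set.Ici 0)))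
    (hHm : Measurable H) (hH : AntitoneOn H (Set.Ioi 0)) {a b : ℝ} (ha : 0 < a) (hab : a < b) :
    ENNReal.ofReal (Real.exp (-a)) * ENNReal.ofReal (Real.exp (-(b - a)) * (b - a)) *
        nexp (ENNReal.ofReal b * ∫⁻ v in Set.Ici 1, (1 - nexp (H v))) ≤
    ∫⁻ ω in {ω | hitCount U (Set.Iio a) ω = 0 ∧ hitCount U (Set.Ico a b) ω = 1},
        ratioFactor H (fun j => U j ω) ∂μ := by
  have hb : 0 < b := ha.trans hab
  have h0m : Measurable (({1} : Set ℝ≥0∞).indicator (1 : ℝ≥0∞ → ℝ≥0∞)) :=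
    measurable_one.indicator (measurableSet_singleton _)
  have key := lintegral_mul_nexp_tail hU hHm ha hab hb h0m
    (Set.indicator_le_self' (fun _ _ => zero_le))
  have hI : MeasurableSet (hitCount U (Set.Ico a b) ⁻¹' {1}) :=
    hU.measurable_hitCount measurableSet_Ico (measurableSet_singleton 1)
  have h1 : ∫⁻ ω, ({1} : Set ℝ≥0∞).indicator (1 : ℝ≥0∞ → ℝ≥0∞)
      (hitCount U (Set.Ico a b) ω) ∂μ = ENNReal.ofReal (Real.exp (-(b - a)) * (b - a)) := by
    have h1' : (fun ω => ({1} : Set ℝ≥0∞).indicator (1 : ℝ≥0∞ → ℝ≥0∞)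
        (hitCount U (Set.Ico a b) ω)) = (hitCount U (Set.Ico a b) ⁻¹' {1}).indicator 1 := rfl
    rw [h1', lintegral_indicator_one hI]
    have h2 := hU.measure_hitCount_eq (B := Set.Ico a b) measurableSet_Ico
      (by rw [volume_restrict_Ico ha.le]; exact ENNReal.ofReal_ne_top) 1
    rw [volume_restrict_Ico ha.le, ENNReal.toReal_ofReal (by linarith)] at h2
    simpa using h2
  rw [h1, div_self hb.ne'] at key
  rw [← key, ← lintegral_indicator (by
    exact ((hU.measurable_hitCount measurableSet_Iio (measurableSet_singleton 0)).inter hI))]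
  refine lintegral_mono fun ω => ?_
  by_cases h0 : hitCount U (Set.Iio a) ω = 0
  swap
  · rw [Set.indicator_of_notMem (by exact h0), zero_mul, zero_mul]; exact zero_le
  by_cases hone : hitCount U (Set.Ico a b) ω = 1
  swap
  · rw [Set.indicator_of_notMem (s := {1}) (by exact hone), mul_zero, zero_mul]; exact zero_le
  rw [Set.indicator_of_mem (by exact h0), Set.indicator_of_mem (s := {1}) (by exact hone),
    Set.indicator_of_mem (by exact ⟨h0, hone⟩), Pi.one_apply, Pi.one_apply, one_mul, one_mul]
  rw [hitCount_eq_zero_iff] at h0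
  obtain ⟨k, hk⟩ := exists_of_hitCount_eq_one hone
  have hkm := (hk k).2 rfl
  have hge : ∀ j, j ≠ k → b ≤ U j ω := by
    intro j hj
    by_contra hlt
    exact hj ((hk j).1 ⟨not_lt.1 (h0 j), not_le.1 hlt⟩)
  have hkmin : argminIndex (fun j => U j ω) = k :=
    argminIndex_eq_of_lt fun j hj => hkm.2.trans_le (hge j hj)
  rw [ratioFactor, hkmin]
  refine nexp_antitone (ENNReal.tsum_le_tsum fun j => ?_)
  by_cases hj : j = k
  · rw [if_pos hj]; exact zero_le
  · rw [if_neg hj, Set.indicator_of_mem (by exact hge j hj)]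
    have hk0 : 0 < U k ω := ha.trans_le hkm.1
    have hj0 : 0 < U j ω := hb.trans_le (hge j hj)
    exact hH (div_pos hj0 hb) (div_pos hj0 hk0)
      (div_le_div_of_nonneg_left hj0.le hk0 hkm.2.le)

/-- The integral from `b / a` misses at most `b / a - 1` of the one from `1`, since the integrand is
at most `1`. After multiplication by `a` this costs a factor `e^{b-a}`, which tends to `1` with the
mesh. -/
lemma setLIntegral_ratioFactor_le_ofReal
    (hU : IsPoissonWithIntensity μ U (volume.restrict (Set.Ici 0)))
    (hHm : Measurable H) (hH : AntitoneOn H (Set.Ioi 0)) {J : ℝ} (hJ0 : 0 ≤ J)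
    (hJ : ∫⁻ v in Set.Ici 1, (1 - nexp (H v)) = ENNReal.ofReal J) {a b : ℝ} (ha : 0 < a)
    (hab : a < b) :
    ∫⁻ ω in {ω | hitCount U (Set.Iio a) ω = 0 ∧ hitCount U (Set.Ico a b) ω ≠ 0},
        ratioFactor H (fun j => U j ω) ∂μ ≤
      ENNReal.ofReal ((Real.exp (b - a) - 1) * Real.exp (-(a * (1 + J)))) := by
  refine (setLIntegral_ratioFactor_le hU hHm hH ha hab).trans ?_
  set K := ∫⁻ v in Set.Ici (b / a), (1 - nexp (H v)) with hK
  have hba : 1 ≤ b / a := (one_le_div ha).2 hab.le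
  have h1 : ENNReal.ofReal J ≤ ENNReal.ofReal (b / a - 1) + K := by
    rw [← hJ, ← Set.Ico_union_Ici_eq_Ici hba]
    refine (lintegral_union_le _ _ _).trans (add_le_add_left ?_ _)
    calc ∫⁻ v in Set.Ico 1 (b / a), (1 - nexp (H v)) ≤ ∫⁻ v in Set.Ico 1 (b / a), 1 :=
          lintegral_mono fun v => tsub_le_self
      _ = ENNReal.ofReal (b / a - 1) := by simp
  have h2 : ENNReal.ofReal (a * J) ≤ ENNReal.ofReal (b - a) + ENNReal.ofReal a * K := by
    calc ENNReal.ofReal (a * J) = ENNReal.ofReal a * ENNReal.ofReal J := ENNReal.ofReal_mul ha.le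
      _ ≤ ENNReal.ofReal a * (ENNReal.ofReal (b / a - 1) + K) := by gcongr
      _ = ENNReal.ofReal (b - a) + ENNReal.ofReal a * K := by
        rw [mul_add, ← ENNReal.ofReal_mul ha.le]
        congr 2; field_simp
  have h3 := nexp_antitone h2
  rw [nexp_add, nexp_ofReal (by linarith), nexp_ofReal (by positivity)] at h3
  have h4 : nexp (ENNReal.ofReal a * K) ≤
      ENNReal.ofReal (Real.exp (b - a)) * ENNReal.ofReal (Real.exp (-(a * J))) := by
    calc nexp (ENNReal.ofReal a * K) = ENNReal.ofReal (Real.exp (b - a)) *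
          (ENNReal.ofReal (Real.exp (-(b - a))) * nexp (ENNReal.ofReal a * K)) := by
          rw [← mul_assoc, ← ENNReal.ofReal_mul (Real.exp_pos _).le, ← Real.exp_add, add_neg_cancel,
            Real.exp_zero, ENNReal.ofReal_one, one_mul]
      _ ≤ _ := by gcongr
  have h5 : 0 ≤ 1 - Real.exp (-(b - a)) := by
    rw [sub_nonneg, Real.exp_le_one_iff]; linarith
  refine (mul_le_mul_right h4 _).trans (le_of_eq ?_)
  rw [← ENNReal.ofReal_mul (Real.exp_pos _).le, ← ENNReal.ofReal_mul (Real.exp_pos _).le,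
    ← ENNReal.ofReal_mul (by positivity)]
  congr 1
  rw [show -(a * (1 + J)) = -a + -(a * J) by ring, Real.exp_add]
  have h6 : Real.exp (-(b - a)) * Real.exp (b - a) = 1 := by
    rw [← Real.exp_add, neg_add_cancel, Real.exp_zero]
  linear_combination (-(Real.exp (-a) * Real.exp (-(a * J)))) * h6

lemma ofReal_le_setLIntegral_ratioFactor
    (hU : IsPoissonWithIntensity μ U (volume.restrict (Set.Ici 0)))
    (hHm : Measurable H) (hH : AntitoneOn H (Set.Ioi 0)) {J : ℝ} (hJ0 : 0 ≤ J)
    (hJ : ∫⁻ v in Set.Ici 1, (1 - nexp (H v)) = ENNReal.ofReal J) {a b : ℝ} (ha : 0 < a)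
    (hab : a < b) :
    ENNReal.ofReal ((b - a) * Real.exp (-(b * (1 + J)))) ≤
      ∫⁻ ω in {ω | hitCount U (Set.Iio a) ω = 0 ∧ hitCount U (Set.Ico a b) ω = 1},
        ratioFactor H (fun j => U j ω) ∂μ := by
  refine le_trans (le_of_eq ?_) (le_setLIntegral_ratioFactor hU hHm hH ha hab)
  have hb : 0 < b := ha.trans hab
  have hba : 0 < b - a := sub_pos.2 hab
  rw [hJ, ← ENNReal.ofReal_mul hb.le, nexp_ofReal (by positivity),
    ← ENNReal.ofReal_mul (Real.exp_pos _).le, ← ENNReal.ofReal_mul (by positivity)]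
  congr 1
  rw [show -(b * (1 + J)) = -a + -(b - a) + -(b * J) by ring, Real.exp_add, Real.exp_add]
  ring

lemma tsum_ofReal_geometric {x q : ℝ} (hx : 0 ≤ x) (hq0 : 0 ≤ q) (hq1 : q < 1) (m : ℕ) :
    ∑' i : ℕ, ENNReal.ofReal (x * q ^ (i + m)) = ENNReal.ofReal (x * q ^ m / (1 - q)) := by
  have h : HasSum (fun i : ℕ => x * q ^ (i + m)) (x * q ^ m / (1 - q)) := by
    have := (hasSum_geometric_of_lt_one hq0 hq1).mul_left (x * q ^ m)
    simpa only [div_eq_mul_inv, pow_add, mul_assoc, mul_comm, mul_left_comm] using this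
  rw [← ENNReal.ofReal_tsum_of_nonneg (fun i => by positivity) h.summable, h.tsum_eq]

/-- Sums the upper bounds over the cells `[ih, (i+1)h)`. They form a geometric series of ratio
`e^{-h(1+J)}`. -/
lemma lintegral_ratioFactor_le (hU : IsPoissonWithIntensity μ U (volume.restrict (Set.Ici 0)))
    (hU0 : ∀ k ω, 0 ≤ U k ω)
    (hHm : Measurable H) (hH : AntitoneOn H (Set.Ioi 0)) {J : ℝ} (hJ0 : 0 ≤ J)
    (hJ : ∫⁻ v in Set.Ici 1, (1 - nexp (H v)) = ENNReal.ofReal J) {h : ℝ} (hh : 0 < h) :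
    ∫⁻ ω, ratioFactor H (fun j => U j ω) ∂μ ≤
      ENNReal.ofReal ((1 - Real.exp (-h)) + (Real.exp h - 1) * Real.exp (-(h * (1 + J))) /
        (1 - Real.exp (-(h * (1 + J))))) := by
  set q := Real.exp (-(h * (1 + J))) with hq
  have hq1 : q < 1 := by rw [hq, Real.exp_lt_one_iff]; nlinarith
  have hq0 : 0 ≤ q := (Real.exp_pos _).le
  have he1 : 0 ≤ 1 - Real.exp (-h) := by rw [sub_nonneg, Real.exp_le_one_iff]; linarith
  have he2 : 0 ≤ Real.exp h - 1 := by rw [sub_nonneg, Real.one_le_exp_iff]; exact hh.le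
  let S : ℕ → Set Ω := fun i => {ω | hitCount U (Set.Iio (i * h)) ω = 0 ∧
    hitCount U (Set.Ico (i * h) ((i + 1) * h)) ω ≠ 0}
  have hcov : ⋃ i, S i = Set.univ := by
    refine Set.eq_univ_of_forall fun ω => Set.mem_iUnion.2 ?_
    -- The point of index `0` lies in some cell, so there is a first nonempty cell; it contains the
    -- smallest point.
    have hex : ∃ i : ℕ, hitCount U (Set.Iio ((i + 1) * h)) ω ≠ 0 := by
      obtain ⟨n, hn⟩ := exists_nat_gt (U 0 ω / h)
      refine ⟨n, fun h0 => hitCount_eq_zero_iff.1 h0 0 ?_⟩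
      have : U 0 ω < n * h := (div_lt_iff₀ hh).1 hn
      exact this.trans (by nlinarith)
    classical
    let i := Nat.find hex
    have hi : hitCount U (Set.Iio ((i + 1) * h)) ω ≠ 0 := Nat.find_spec hex
    have hi0 : hitCount U (Set.Iio (i * h)) ω = 0 := by
      rcases Nat.eq_zero_or_pos i with h0 | h0
      · rw [h0, hitCount_eq_zero_iff]
        intro k hk
        have : U k ω < (0 : ℕ) * h := hk
        rw [Nat.cast_zero, zero_mul] at this
        exact absurd this (not_lt.2 (hU0 k ω))
      · have := Nat.find_min hex (Nat.sub_lt h0 one_pos)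
        rw [not_not] at this
        have hcast : ((Nat.find hex - 1 : ℕ) : ℝ) + 1 = (i : ℝ) := by
          have h1 : Nat.find hex - 1 + 1 = i := Nat.sub_add_cancel h0
          exact_mod_cast h1
        rwa [hcast] at this
    refine ⟨i, hi0, fun h0 => hi ?_⟩
    rw [hitCount_eq_zero_iff] at h0 hi0 ⊢
    exact fun k hk => h0 k ⟨not_lt.1 (hi0 k), hk⟩
  -- The cell bound needs a positive left end. The first cell is bounded by the probability that it
  -- is hit, which vanishes as `h → 0`.
  have h0 : ∫⁻ ω in S 0, ratioFactor H (fun j => U j ω) ∂μ ≤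
      ENNReal.ofReal (1 - Real.exp (-h)) := by
    have hI : MeasurableSet (hitCount U (Set.Iio h) ⁻¹' {0}) :=
      hU.measurable_hitCount measurableSet_Iio (measurableSet_singleton 0)
    have hsub : S 0 ⊆ (hitCount U (Set.Iio h) ⁻¹' {0})ᶜ := by
      rintro ω ⟨-, h2⟩ h3
      refine h2 (hitCount_eq_zero_iff.2 fun k hk => hitCount_eq_zero_iff.1 h3 k ?_)
      have := hk.2
      rwa [Nat.cast_zero, zero_add, one_mul] at this
    have h2 := hU.measure_hitCount_eq (B := Set.Iio h) measurableSet_Iio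
      (by rw [volume_restrict_Iio]; exact ENNReal.ofReal_ne_top) 0
    rw [volume_restrict_Iio, ENNReal.toReal_ofReal hh.le, pow_zero, Nat.factorial_zero,
      Nat.cast_zero] at h2
    calc ∫⁻ ω in S 0, ratioFactor H (fun j => U j ω) ∂μ ≤ ∫⁻ _ in S 0, 1 ∂μ :=
          lintegral_mono fun ω => ratioFactor_le_one _ _
      _ = μ (S 0) := setLIntegral_one _
      _ ≤ μ ((hitCount U (Set.Iio h) ⁻¹' {0})ᶜ) := measure_mono hsub
      _ = ENNReal.ofReal (1 - Real.exp (-h)) := by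
        rw [prob_compl_eq_one_sub hI, h2, ENNReal.ofReal_sub _ (Real.exp_pos _).le]
        simp
  have hsucc : ∀ i : ℕ, ∫⁻ ω in S (i + 1), ratioFactor H (fun j => U j ω) ∂μ ≤
      ENNReal.ofReal ((Real.exp h - 1) * q ^ (i + 1)) := by
    intro i
    have ha : 0 < ((i + 1 : ℕ) : ℝ) * h := by positivity
    refine (setLIntegral_ratioFactor_le_ofReal hU hHm hH hJ0 hJ ha
      (b := (((i + 1 : ℕ) : ℝ) + 1) * h) (by nlinarith)).trans (le_of_eq ?_)
    congr 2
    · congr 2; ring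
    · rw [hq, ← Real.exp_nat_mul]; congr 1; ring
  calc ∫⁻ ω, ratioFactor H (fun j => U j ω) ∂μ
      = ∫⁻ ω in ⋃ i, S i, ratioFactor H (fun j => U j ω) ∂μ := by rw [hcov, setLIntegral_univ]
    _ ≤ ∑' i, ∫⁻ ω in S i, ratioFactor H (fun j => U j ω) ∂μ := lintegral_iUnion_le _ _
    _ = ∫⁻ ω in S 0, ratioFactor H (fun j => U j ω) ∂μ +
        ∑' i, ∫⁻ ω in S (i + 1), ratioFactor H (fun j => U j ω) ∂μ :=
        tsum_eq_zero_add' ENNReal.summable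
    _ ≤ ENNReal.ofReal (1 - Real.exp (-h)) +
        ∑' i : ℕ, ENNReal.ofReal ((Real.exp h - 1) * q ^ (i + 1)) :=
        add_le_add h0 (ENNReal.tsum_le_tsum hsucc)
    _ = _ := by
      rw [tsum_ofReal_geometric he2 hq0 hq1, pow_one, ← ENNReal.ofReal_add he1]
      exact div_nonneg (mul_nonneg he2 hq0) (by linarith)

lemma le_lintegral_ratioFactor (hU : IsPoissonWithIntensity μ U (volume.restrict (Set.Ici 0)))
    (hHm : Measurable H) (hH : AntitoneOn H (Set.Ioi 0)) {J : ℝ} (hJ0 : 0 ≤ J)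
    (hJ : ∫⁻ v in Set.Ici 1, (1 - nexp (H v)) = ENNReal.ofReal J) {h : ℝ} (hh : 0 < h) :
    ENNReal.ofReal (h * Real.exp (-(h * (1 + J))) ^ 2 / (1 - Real.exp (-(h * (1 + J))))) ≤
      ∫⁻ ω, ratioFactor H (fun j => U j ω) ∂μ := by
  set q := Real.exp (-(h * (1 + J))) with hq
  have hq1 : q < 1 := by rw [hq, Real.exp_lt_one_iff]; nlinarith
  have hq0 : 0 ≤ q := (Real.exp_pos _).le
  -- For a lower bound the cell at the origin can be dropped, so the grid starts at `h`. The right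
  -- ends `(i + 2)h` produce the square in the bound.
  let S : ℕ → Set Ω := fun i => {ω | hitCount U (Set.Iio ((i + 1) * h)) ω = 0 ∧
    hitCount U (Set.Ico ((i + 1) * h) ((i + 2) * h)) ω = 1}
  have hSm : ∀ i, MeasurableSet (S i) := fun i =>
    (hU.measurable_hitCount measurableSet_Iio (measurableSet_singleton 0)).inter
      (hU.measurable_hitCount measurableSet_Ico (measurableSet_singleton 1))
  have hlt : ∀ i j : ℕ, i < j → Disjoint (S i) (S j) := by
    intro i j hij
    refine Set.disjoint_left.2 fun ω hi hj => ?_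
    obtain ⟨k, hk⟩ := exists_of_hitCount_eq_one hi.2
    refine hitCount_eq_zero_iff.1 hj.1 k (((hk k).2 rfl).2.trans_le ?_)
    have : (i : ℝ) + 1 ≤ j := by exact_mod_cast hij
    nlinarith
  have hSd : Pairwise (Function.onFun Disjoint S) := by
    intro i j hij
    rcases lt_or_gt_of_ne hij with h' | h'
    · exact hlt i j h'
    · exact (hlt j i h').symm
  have hterm : ∀ i : ℕ, ENNReal.ofReal (h * q ^ (i + 2)) ≤
      ∫⁻ ω in S i, ratioFactor H (fun j => U j ω) ∂μ := by
    intro i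
    refine le_trans (le_of_eq ?_) (ofReal_le_setLIntegral_ratioFactor hU hHm hH hJ0 hJ
      (a := (i + 1) * h) (b := (i + 2) * h) (by positivity) (by nlinarith))
    congr 2
    · ring
    · rw [hq, ← Real.exp_nat_mul]; congr 1; push_cast; ring
  calc _ = ∑' i : ℕ, ENNReal.ofReal (h * q ^ (i + 2)) :=
        (tsum_ofReal_geometric hh.le hq0 hq1 2).symm
    _ ≤ ∑' i, ∫⁻ ω in S i, ratioFactor H (fun j => U j ω) ∂μ := ENNReal.tsum_le_tsum hterm
    _ = ∫⁻ ω in ⋃ i, S i, ratioFactor H (fun j => U j ω) ∂μ := (lintegral_iUnion hSm hSd _).symm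
    _ ≤ _ := setLIntegral_le_lintegral _ _

/-- For a unit Poisson process on the half-line, seen from its smallest point, the mean of the
product of `e^{-H}` over the ratios of the other points to the smallest one. -/
lemma lintegral_ratioFactor (hU : IsPoissonWithIntensity μ U (volume.restrict (Set.Ici 0)))
    (hU0 : ∀ k ω, 0 ≤ U k ω)
    (hHm : Measurable H) (hH : AntitoneOn H (Set.Ioi 0)) {J : ℝ} (hJ0 : 0 ≤ J)
    (hJ : ∫⁻ v in Set.Ici 1, (1 - nexp (H v)) = ENNReal.ofReal J) :
    ∫⁻ ω, ratioFactor H (fun j => U j ω) ∂μ = ENNReal.ofReal (1 + J)⁻¹ := by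
  have hc : 0 < 1 + J := by linarith
  have hexp : Tendsto (fun h : ℝ => Real.exp (-(h * (1 + J)))) (𝓝[>] 0) (𝓝 1) := by
    have : Continuous fun h : ℝ => Real.exp (-(h * (1 + J))) := by fun_prop
    simpa using (this.tendsto 0).mono_left nhdsWithin_le_nhds
  have hden : Tendsto (fun h : ℝ => h⁻¹ * (1 - Real.exp (-(h * (1 + J))))) (𝓝[>] 0)
      (𝓝 (1 + J)) := by
    have hd : HasDerivAt (fun h : ℝ => -Real.exp (-(h * (1 + J)))) (1 + J) 0 := by
      have := (((hasDerivAt_id (0 : ℝ)).mul_const (1 + J)).fun_neg.exp).fun_neg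
      simpa using this
    have := hd.tendsto_slope_zero_right
    refine this.congr fun t => ?_
    simp only [zero_add, zero_mul, neg_zero, Real.exp_zero, smul_eq_mul]
    ring
  have hnum : Tendsto (fun h : ℝ => h⁻¹ * (Real.exp h - 1)) (𝓝[>] 0) (𝓝 1) := by
    have := (Real.hasDerivAt_exp 0).tendsto_slope_zero_right
    simpa using this
  have hone : Tendsto (fun h : ℝ => 1 - Real.exp (-h)) (𝓝[>] 0) (𝓝 0) := by
    have : Continuous fun h : ℝ => 1 - Real.exp (-h) := by fun_prop
    simpa using (this.tendsto 0).mono_left nhdsWithin_le_nhds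
  -- Since `1 - e^{-h(1+J)}` is asymptotic to `h(1+J)`, both geometric sums tend to `(1+J)⁻¹`.
  refine le_antisymm ?_ ?_
  · have hlim : Tendsto (fun h : ℝ => (1 - Real.exp (-h)) + (Real.exp h - 1) *
        Real.exp (-(h * (1 + J))) / (1 - Real.exp (-(h * (1 + J))))) (𝓝[>] 0)
        (𝓝 (1 + J)⁻¹) := by
      have := hone.add ((hnum.mul hexp).div hden hc.ne')
      rw [zero_add, mul_one, one_div] at this
      refine this.congr' ?_
      filter_upwards [self_mem_nhdsWithin] with h hh
      have hh' : h ≠ 0 := ne_of_gt hh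
      rw [Pi.div_apply]
      rw [mul_assoc, mul_div_mul_left _ _ (inv_ne_zero hh')]
    refine ge_of_tendsto (ENNReal.tendsto_ofReal hlim) ?_
    filter_upwards [self_mem_nhdsWithin] with h hh
    exact lintegral_ratioFactor_le hU hU0 hHm hH hJ0 hJ hh
  · have hlim : Tendsto (fun h : ℝ => h * Real.exp (-(h * (1 + J))) ^ 2 /
        (1 - Real.exp (-(h * (1 + J))))) (𝓝[>] 0) (𝓝 (1 + J)⁻¹) := by
      have := (hexp.pow 2).div hden hc.ne'
      rw [one_pow, one_div] at this
      refine this.congr' ?_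
      filter_upwards [self_mem_nhdsWithin] with h hh
      have hh' : h ≠ 0 := ne_of_gt hh
      rw [Pi.div_apply, ← mul_div_mul_left _ _ hh', mul_inv_cancel_left₀ hh']
    refine le_of_tendsto (ENNReal.tendsto_ofReal hlim) ?_
    filter_upwards [self_mem_nhdsWithin] with h hh
    exact le_lintegral_ratioFactor hU hHm hH hJ0 hJ hh

end NearestPoint

/-! ### An integral representation of `₂F₁(1, -1/a; 1 - 1/a; z)` -/

section Hypergeometric

/-- The chosen continuation and `F` both equal the series on `(-1, 1)`, so the identity theorem on
the connected set `(-∞, 1)` applies. -/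
lemma gaussHypergeometric_eq {a b c : ℝ} {F : ℝ → ℝ} (hF : IsGaussHypergeometric a b c F) {z : ℝ}
    (hz : z < 1) : gaussHypergeometric a b c z = F z := by
  have h : ∃ F : ℝ → ℝ, IsGaussHypergeometric a b c F := ⟨F, hF⟩
  rw [gaussHypergeometric, dif_pos h]
  have h1 := h.choose_spec
  refine h1.1.eqOn_of_preconnected_of_eventuallyEq hF.1 isPreconnected_Iio
    (show (0 : ℝ) ∈ Set.Iio 1 by simp) ?_ hz
  filter_upwards [Ioo_mem_nhds (show (-1 : ℝ) < 0 by norm_num) one_pos] with x hx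
  rw [h1.2 x hx, hF.2 x hx]

variable {a : ℝ}

/-- The function `z ↦ ∫_1^∞ (u^a - z)⁻¹ du`. -/
noncomputable def rpowStieltjes (a z : ℝ) : ℝ := ∫ u in Set.Ioi (1 : ℝ), (u ^ a - z)⁻¹

lemma one_sub_lt_rpow_sub (ha : 1 < a) {u : ℝ} (hu : 1 < u) (z : ℝ) : 1 - z < u ^ a - z := by
  have := Real.one_lt_rpow hu (by linarith : 0 < a)
  linarith

lemma integrableOn_inv_rpow_sub (ha : 1 < a) {z : ℝ} (hz : z < 1) :
    IntegrableOn (fun u : ℝ => (u ^ a - z)⁻¹) (Set.Ioi 1) := by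
  -- For `u > 1`, `u^a - z ≥ min(1, 1 - z) u^a`: trivially if `z ≤ 0`, and from `z ≤ z u^a`
  -- otherwise.
  have hb : 0 < min 1 (1 - z) := lt_min one_pos (by linarith)
  have hint : IntegrableOn (fun u : ℝ => (min 1 (1 - z))⁻¹ * u ^ (-a)) (Set.Ioi 1) :=
    (integrableOn_Ioi_rpow_of_lt (by linarith) one_pos).const_mul _
  refine Integrable.mono' hint (by fun_prop) ?_
  refine (ae_restrict_mem measurableSet_Ioi).mono fun u hu => ?_
  have hu1 : 1 < u := hu
  have hpos : 0 < u ^ a - z := lt_trans (by linarith) (one_sub_lt_rpow_sub ha hu1 z)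
  have h1 : 1 ≤ u ^ a := Real.one_le_rpow hu1.le (by linarith)
  rw [Real.norm_of_nonneg (inv_nonneg.2 hpos.le), Real.rpow_neg (by linarith), ← mul_inv]
  refine inv_anti₀ (by positivity) ?_
  rcases le_total z 0 with h | h
  · rw [min_eq_left (by linarith)]; linarith
  · rw [min_eq_right (by linarith)]; nlinarith

/-- Expands `(u^a - z - w)⁻¹` geometrically in `w` and integrates termwise. The ratio is at most
`|w| / (1 - z) < 1` uniformly in `u`. This gives analyticity at every `z < 1`, and at `z = 0` the
Taylor coefficients. -/
lemma hasSum_rpowStieltjes (ha : 1 < a) {z w : ℝ} (hz : z < 1) (hw : |w| < 1 - z) :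
    HasSum (fun n : ℕ => w ^ n * ∫ u in Set.Ioi (1 : ℝ), ((u ^ a - z)⁻¹) ^ (n + 1))
      (rpowStieltjes a (z + w)) := by
  have hb : 0 < 1 - z := by linarith
  have hI := integrableOn_inv_rpow_sub ha hz
  have hbound : ∀ n : ℕ, ∀ u ∈ Set.Ioi (1 : ℝ),
      ‖w ^ n * ((u ^ a - z)⁻¹) ^ (n + 1)‖ ≤ (|w| / (1 - z)) ^ n * (u ^ a - z)⁻¹ := by
    intro n u hu
    have hlt := one_sub_lt_rpow_sub ha hu z
    have hpos : 0 < u ^ a - z := hb.trans hlt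
    rw [norm_mul, norm_pow, norm_pow, Real.norm_of_nonneg (inv_nonneg.2 hpos.le), Real.norm_eq_abs,
      pow_succ, ← mul_assoc, ← mul_pow]
    refine mul_le_mul_of_nonneg_right (pow_le_pow_left₀ (by positivity) ?_ n)
      (inv_nonneg.2 hpos.le)
    rw [div_eq_mul_inv]
    exact mul_le_mul_of_nonneg_left (inv_anti₀ hb hlt.le) (abs_nonneg _)
  have hmeas : ∀ n : ℕ, AEStronglyMeasurable (fun u : ℝ => w ^ n * ((u ^ a - z)⁻¹) ^ (n + 1))
      (volume.restrict (Set.Ioi 1)) := fun n => by fun_prop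
  have hF : ∀ n : ℕ, Integrable (fun u : ℝ => w ^ n * ((u ^ a - z)⁻¹) ^ (n + 1))
      (volume.restrict (Set.Ioi 1)) := fun n =>
    Integrable.mono' (hI.const_mul ((|w| / (1 - z)) ^ n)) (hmeas n)
      ((ae_restrict_mem measurableSet_Ioi).mono (hbound n))
  have hq1 : |w| / (1 - z) < 1 := (div_lt_one hb).2 hw
  have hsum : Summable fun n : ℕ => ∫ u in Set.Ioi (1 : ℝ),
      ‖w ^ n * ((u ^ a - z)⁻¹) ^ (n + 1)‖ := by
    refine Summable.of_nonneg_of_le (fun n => integral_nonneg_of_ae (ae_of_all _ fun u => norm_nonneg _)) (fun n => ?_)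
      ((summable_geometric_of_lt_one (by positivity) hq1).mul_right
        (∫ u in Set.Ioi (1 : ℝ), (u ^ a - z)⁻¹))
    rw [← integral_const_mul]
    exact setIntegral_mono_on (hF n).norm (hI.const_mul _) measurableSet_Ioi (hbound n)
  have key := hasSum_integral_of_summable_integral_norm hF hsum
  simp_rw [integral_const_mul] at key
  have heq : rpowStieltjes a (z + w) =
      ∫ u in Set.Ioi (1 : ℝ), ∑' n : ℕ, w ^ n * ((u ^ a - z)⁻¹) ^ (n + 1) := by
    rw [rpowStieltjes]
    refine setIntegral_congr_fun measurableSet_Ioi fun u hu => ?_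
    have hlt := one_sub_lt_rpow_sub ha hu z
    have hpos : 0 < u ^ a - z := hb.trans hlt
    have hr : ‖w * (u ^ a - z)⁻¹‖ < 1 := by
      rw [norm_mul, Real.norm_of_nonneg (inv_nonneg.2 hpos.le), Real.norm_eq_abs, ← div_eq_mul_inv,
        div_lt_one hpos]
      exact hw.trans hlt
    have hg := (hasSum_geometric_of_norm_lt_one hr).mul_right (u ^ a - z)⁻¹
    have h1 : ∀ n : ℕ, w ^ n * ((u ^ a - z)⁻¹) ^ (n + 1) =
        (w * (u ^ a - z)⁻¹) ^ n * (u ^ a - z)⁻¹ := fun n => by rw [mul_pow, pow_succ, mul_assoc]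
    simp only [h1]
    rw [hg.tsum_eq, ← mul_inv]
    congr 1
    field_simp
    ring
  rw [heq]
  exact key

lemma analyticAt_rpowStieltjes (ha : 1 < a) {z : ℝ} (hz : z < 1) :
    AnalyticAt ℝ (rpowStieltjes a) z := by
  refine ⟨FormalMultilinearSeries.ofScalars ℝ
    (fun n : ℕ => ∫ u in Set.Ioi (1 : ℝ), ((u ^ a - z)⁻¹) ^ (n + 1)), ?_⟩
  rw [hasFPowerSeriesAt_iff]
  filter_upwards [Metric.ball_mem_nhds (0 : ℝ) (sub_pos.2 hz)] with w hw
  simp_rw [FormalMultilinearSeries.coeff_ofScalars, smul_eq_mul]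
  exact hasSum_rpowStieltjes ha hz (by simpa using hw)

lemma integral_Ioi_inv_rpow_pow (ha : 1 < a) (n : ℕ) :
    ∫ u in Set.Ioi (1 : ℝ), ((u ^ a - 0)⁻¹) ^ (n + 1) = (a * (n + 1) - 1)⁻¹ := by
  have hn : 1 < a * (n + 1) := by nlinarith [(Nat.cast_nonneg n : (0 : ℝ) ≤ n)]
  have h1 : ∫ u in Set.Ioi (1 : ℝ), ((u ^ a - 0)⁻¹) ^ (n + 1) =
      ∫ u in Set.Ioi (1 : ℝ), u ^ (-(a * (n + 1))) := by
    refine setIntegral_congr_fun measurableSet_Ioi fun u hu => ?_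
    have hu0 : 0 ≤ u := zero_le_one.trans (le_of_lt hu)
    simp only [sub_zero]
    rw [Real.rpow_neg hu0, Real.rpow_mul hu0, inv_pow]
    congr 1
    exact_mod_cast (Real.rpow_natCast (u ^ a) (n + 1)).symm
  rw [h1, integral_Ioi_rpow_of_lt (by linarith) one_pos, Real.one_rpow]
  rw [neg_div, one_div, ← inv_neg]
  congr 1; ring

/-- The symbol `(1)_{n+1}` cancels the factorial, and `(-1/a)_{n+1} = -(1/a) (1 - 1/a)_n` cancels
all but the last factor of `(1 - 1/a)_{n+1}`. -/
lemma ordinaryHypergeometricCoefficient_succ (ha : 1 < a) (n : ℕ) :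
    ordinaryHypergeometricCoefficient 1 (-(1 / a)) (1 - 1 / a) (n + 1) =
      -(a * (n + 1) - 1)⁻¹ := by
  have ha0 : a ≠ 0 := by linarith
  have hfac : ∀ n : ℕ, (ascPochhammer ℝ n).eval 1 = n.factorial := fun n => by
    rw [ascPochhammer_eval_one]
  have hlt : 1 / a < 1 := (div_lt_one (by linarith)).2 ha
  have hpos : ∀ n : ℕ, (ascPochhammer ℝ n).eval (1 - 1 / a) ≠ 0 := fun n =>
    (ascPochhammer_pos n _ (by linarith)).ne'
  have hshift : ∀ n : ℕ, (ascPochhammer ℝ (n + 1)).eval (-(1 / a)) =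
      -(1 / a) * (ascPochhammer ℝ n).eval (1 - 1 / a) := by
    intro n
    rw [ascPochhammer_succ_left, Polynomial.eval_mul, Polynomial.eval_X, Polynomial.eval_comp]
    congr 2
    simp; ring
  have hd : a * (n + 1) - 1 ≠ 0 := by nlinarith [(Nat.cast_nonneg n : (0 : ℝ) ≤ n)]
  have hd' : 1 - 1 / a + n ≠ 0 := by
    have : 1 - 1 / a + n = (a * (n + 1) - 1) / a := by field_simp; ring
    rw [this]
    exact div_ne_zero hd ha0
  rw [ordinaryHypergeometricCoefficient, hfac, hshift, ascPochhammer_succ_eval,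
    inv_mul_cancel₀ (by positivity), one_mul]
  have := hpos n
  rw [mul_inv, mul_assoc, mul_inv_cancel_left₀ this]
  have h3 : 1 - 1 / a + n = (a * (n + 1) - 1) / a := by field_simp; ring
  rw [h3, inv_div]
  field_simp

/-- The Taylor coefficients of the integral at `0` are `∫_1^∞ u^{-a(n+1)} du = (a(n+1) - 1)⁻¹`,
minus the shifted hypergeometric coefficients; the integral itself is analytic on all of `(-∞, 1)`.
-/
lemma isGaussHypergeometric_rpowStieltjes (ha : 1 < a) :
    IsGaussHypergeometric 1 (-(1 / a)) (1 - 1 / a) (fun z => 1 - z * rpowStieltjes a z) := by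
  refine ⟨fun z hz => analyticAt_const.sub (analyticAt_id.mul (analyticAt_rpowStieltjes ha hz)),
    fun z hz => ?_⟩
  have h := hasSum_rpowStieltjes ha (z := 0) one_pos (w := z) (by simpa [abs_lt] using hz)
  simp_rw [integral_Ioi_inv_rpow_pow ha, zero_add] at h
  have hc : ∀ n : ℕ, ordinaryHypergeometricCoefficient 1 (-(1 / a)) (1 - 1 / a) (n + 1) •
      z ^ (n + 1) = -(z * (z ^ n * (a * (n + 1) - 1)⁻¹)) := by
    intro n
    rw [ordinaryHypergeometricCoefficient_succ ha, smul_eq_mul, pow_succ]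
    ring
  have h0 : ordinaryHypergeometricCoefficient 1 (-(1 / a)) (1 - 1 / a) 0 • z ^ 0 = 1 := by
    simp [ordinaryHypergeometricCoefficient]
  have h1 := (h.mul_left z).neg
  simp_rw [← hc] at h1
  have h2 := HasSum.zero_add
    (f := fun n => ordinaryHypergeometricCoefficient 1 (-(1 / a)) (1 - 1 / a) n • z ^ n) h1
  rw [h0] at h2
  rw [ordinaryHypergeometric_eq_tsum]
  exact (sub_eq_add_neg _ _).trans h2.tsum_eq.symm

/-- Integral representation of `₂F₁(1, -1/a; 1 - 1/a; -x)`. -/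
lemma gaussHypergeometric_neg_eq (ha : 1 < a) {x : ℝ} (hx : 0 ≤ x) :
    gaussHypergeometric 1 (-(1 / a)) (1 - 1 / a) (-x) =
      1 + ∫ u in Set.Ioi (1 : ℝ), x * (u ^ a + x)⁻¹ := by
  rw [gaussHypergeometric_eq (isGaussHypergeometric_rpowStieltjes ha) (by linarith), rpowStieltjes,
    integral_const_mul]
  simp only [sub_neg_eq_add]
  ring

end Hypergeometric

/-! ### Positivity of the fitted scale -/

/-- Log-convexity of the Gamma function at the midpoint of `m` and `m + 1`, with `Γ(m+1) = m Γ(m)`.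
It yields that the mean of `|h||r|` is at most `1`, hence a nonnegative variance. -/
lemma Real.Gamma_add_half_le {m : ℝ} (hm : 0 < m) :
    Real.Gamma (m + 1 / 2) ≤ m ^ (1 / 2 : ℝ) * Real.Gamma m := by
  have h := Real.Gamma_mul_add_mul_le_rpow_Gamma_mul_rpow_Gamma (a := 1 / 2) (b := 1 / 2) hm
    (show 0 < m + 1 by linarith) (by norm_num) (by norm_num) (by norm_num)
  have hG := Real.Gamma_pos_of_pos hm
  rw [Real.Gamma_add_one hm.ne', Real.mul_rpow hm.le hG.le, mul_left_comm,
    ← Real.rpow_add hG] at h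
  convert h using 2
  · ring
  · norm_num

namespace RISParams

variable {P : RISParams}

lemma Admissible.meanHR_nonneg (hP : P.Admissible) : 0 ≤ P.meanHR := by
  have h1 := hP.half_le_mh
  have h2 := hP.half_le_mr
  have := Real.Gamma_pos_of_pos (show 0 < P.mh + 1 / 2 by linarith)
  have := Real.Gamma_pos_of_pos (show 0 < P.mr + 1 / 2 by linarith)
  have := Real.Gamma_pos_of_pos (show 0 < P.mh by linarith)
  have := Real.Gamma_pos_of_pos (show 0 < P.mr by linarith)
  have : 0 < P.mh * P.mr := mul_pos (by linarith) (by linarith)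
  unfold meanHR
  positivity

lemma Admissible.meanHR_le_one (hP : P.Admissible) : P.meanHR ≤ 1 := by
  have h1 : 0 < P.mh := by linarith [hP.half_le_mh]
  have h2 : 0 < P.mr := by linarith [hP.half_le_mr]
  have hh := Real.Gamma_add_half_le h1
  have hr := Real.Gamma_add_half_le h2
  rw [← div_le_iff₀ (Real.Gamma_pos_of_pos h1)] at hh
  rw [← div_le_iff₀ (Real.Gamma_pos_of_pos h2)] at hr
  have hr0 : 0 ≤ Real.Gamma (P.mr + 1 / 2) / Real.Gamma P.mr :=
    div_nonneg (Real.Gamma_nonneg_of_nonneg (by linarith)) (Real.Gamma_nonneg_of_nonneg h2.le)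
  calc P.meanHR ≤ P.mh ^ (1 / 2 : ℝ) * P.mr ^ (1 / 2 : ℝ) * (1 / (P.mh * P.mr)) ^ (1 / 2 : ℝ) := by
        unfold meanHR
        gcongr
    _ = 1 := by
      rw [← Real.mul_rpow h1.le h2.le, ← Real.mul_rpow (by positivity) (by positivity),
        mul_one_div_cancel (by positivity), Real.one_rpow]

lemma Admissible.variance_nonneg (hP : P.Admissible) :
    0 ≤ P.secondMomentSr - P.meanSr ^ 2 := by
  have h : P.secondMomentSr - P.meanSr ^ 2 = P.N * (1 - P.meanHR ^ 2) := by
    unfold secondMomentSr meanSr; ring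
  rw [h]
  have h2 : P.meanHR ^ 2 ≤ 1 := pow_le_one₀ hP.meanHR_nonneg hP.meanHR_le_one
  exact mul_nonneg (Nat.cast_nonneg _) (by linarith)

lemma Admissible.kappaR_nonneg (hP : P.Admissible) : 0 ≤ P.kappaR :=
  div_nonneg (sq_nonneg _) hP.variance_nonneg

lemma Admissible.omegaR_nonneg (hP : P.Admissible) : 0 ≤ P.omegaR :=
  div_nonneg hP.variance_nonneg (mul_nonneg (Nat.cast_nonneg _) hP.meanHR_nonneg)

lemma Admissible.muS_succ (hP : P.Admissible) (q : ℕ) :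
    P.muS (q + 1) = P.omegaR * (q + P.kappaR) * P.muS q := by
  -- Only `κ_r ≥ 0` is available here. At `κ_r = 0` both sides vanish by the conventions `Γ(0) = 0`
  -- and `x / 0 = 0`.
  rcases hP.kappaR_nonneg.eq_or_lt with h | h
  · have h0 : Real.Gamma P.kappaR = 0 := by rw [← h, Real.Gamma_zero]
    simp [muS, h0]
  · have : 0 < q + P.kappaR := by positivity
    unfold muS
    rw [show ((q + 1 : ℕ) : ℝ) + P.kappaR = (q + P.kappaR) + 1 by push_cast; ring,
      Real.Gamma_add_one this.ne', pow_succ]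
    ring

lemma Admissible.muS_one (hP : P.Admissible) : P.muS 1 = P.omegaR * P.kappaR := by
  rcases hP.kappaR_nonneg.eq_or_lt with h | h
  · simp [muS, ← h]
  · have := (Real.Gamma_pos_of_pos h).ne'
    unfold muS
    rw [Nat.cast_one, add_comm, Real.Gamma_add_one h.ne']
    field_simp

lemma muG_one_pos : 0 < muG 1 := Real.Gamma_pos_of_pos (by positivity)

lemma muG_one_sq_le : muG 1 ^ 2 ≤ 1 := by
  have h : muG 1 = 1 / 2 * √Real.pi := by
    unfold muG
    rw [Nat.cast_one, add_comm, Real.Gamma_add_one (by norm_num), Real.Gamma_one_half_eq]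
  rw [h, mul_pow, Real.sq_sqrt Real.pi_pos.le]
  nlinarith [Real.pi_le_four]

lemma muG_two : muG 2 = 1 := by
  unfold muG
  rw [show (1 : ℝ) + (2 : ℕ) / 2 = 1 + 1 by norm_num, Real.Gamma_add_one one_ne_zero,
    Real.Gamma_one, one_mul]

lemma muG_three : muG 3 = 3 / 2 * muG 1 := by
  unfold muG
  rw [show (1 : ℝ) + (3 : ℕ) / 2 = 3 / 2 + 1 by norm_num, Real.Gamma_add_one (by norm_num)]
  norm_num

lemma muG_four : muG 4 = 2 := by
  unfold muG
  rw [show (1 : ℝ) + (4 : ℕ) / 2 = (1 + 1) + 1 by norm_num, Real.Gamma_add_one (by norm_num),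
    Real.Gamma_add_one one_ne_zero, Real.Gamma_one]
  norm_num

lemma Admissible.chi1_pos (hP : P.Admissible) : 0 < P.chi1 := by
  have hk := hP.kappaR_nonneg
  have ho := hP.omegaR_nonneg
  have hb : 0 ≤ P.beta := Real.sqrt_nonneg _
  have hm := muG_one_pos
  have h2 := hP.muS_succ 1
  rw [chi1, muG_two, h2, hP.muS_one]
  positivity

/-- The recursions for the moments turn the difference into a polynomial in `β, ω_r, κ_r` and `μ_1`.
Its one term of unclear sign contains `1 - μ_1² = 1 - π/4 ≥ 0`, and its constant term `μ_4 - μ_2² =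
1` makes it positive. -/
lemma Admissible.chi1_sq_lt_chi2 (hP : P.Admissible) : P.chi1 ^ 2 < P.chi2 := by
  have hk := hP.kappaR_nonneg
  have ho := hP.omegaR_nonneg
  have hb : 0 ≤ P.beta := Real.sqrt_nonneg _
  have hm := muG_one_pos
  have h2 := hP.muS_succ 1
  have h3 := hP.muS_succ 2
  have h4 := hP.muS_succ 3
  rw [hP.muS_one] at h2
  norm_num at h2 h3 h4
  rw [h2] at h3
  rw [h3] at h4
  rw [← sub_pos]
  have hsq := muG_one_sq_le
  unfold chi1 chi2
  rw [muG_two, muG_three, muG_four, hP.muS_one, h2, h3, h4]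
  set κ := P.kappaR
  set ω := P.omegaR
  set b := P.beta
  set m := muG 1
  have hd : 0 ≤ b ^ 2 * ω ^ 2 * κ ^ 2 * (1 - m ^ 2) :=
    mul_nonneg (by positivity) (by linarith)
  have e : 0 < 1 + 2 * b * m * (ω * κ) + 4 * (b ^ 2 * ω ^ 2 * κ ^ 2 * (1 - m ^ 2)) +
    4 * b ^ 2 * ω ^ 2 * κ + 8 * b ^ 3 * m * ω ^ 3 * κ * (1 + κ) +
    b ^ 4 * ω ^ 4 * κ * (1 + κ) * (4 * κ + 6) := by positivity
  refine e.trans_le (le_of_eq ?_)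
  ring

lemma Admissible.chiBar_pos (hP : P.Admissible) : 0 < P.chiBar :=
  div_pos (sub_pos.2 hP.chi1_sq_lt_chi2) hP.chi1_pos

lemma one_le_kappaHat (P : RISParams) : 1 ≤ P.kappaHat := le_max_left _ _

lemma Admissible.e1_pos (hP : P.Admissible) : 0 < P.e1 := by
  have := hP.Cd_pos
  have := hP.Cr_pos
  have := hP.d0_pos
  unfold e1
  positivity

end RISParams

/-! ### Tails and Laplace transforms of gamma laws of integer shape -/

/-- The tail `∑_{i < k} y^i e^{-y} / i!` of the gamma law of shape `k` and scale `1`. -/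
noncomputable def gammaTail (k : ℕ) (y : ℝ≥0∞) : ℝ≥0∞ :=
  ∑ i ∈ Finset.range k, ENNReal.ofReal (i.factorial : ℝ)⁻¹ * (y ^ i * nexp y)

lemma measurable_gammaTail (k : ℕ) : Measurable (gammaTail k) :=
  Finset.measurable_fun_sum _ fun i _ => (((measurable_id.pow_const i).mul measurable_nexp).const_mul _)

lemma gammaTail_one (y : ℝ≥0∞) : gammaTail 1 y = nexp y := by simp [gammaTail]

/-- The derivative telescopes, leaving minus the gamma density of shape `n + 1`. -/
lemma hasDerivAt_sum_pow_mul_exp_neg (n : ℕ) (x : ℝ) :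
    HasDerivAt (fun x : ℝ => ∑ i ∈ Finset.range (n + 1), (i.factorial : ℝ)⁻¹ *
      (x ^ i * Real.exp (-x))) (-((n.factorial : ℝ)⁻¹ * (x ^ n * Real.exp (-x)))) x := by
  have he : HasDerivAt (fun x : ℝ => Real.exp (-x)) (-Real.exp (-x)) x := by
    simpa using (hasDerivAt_neg x).exp
  induction n with
  | zero => simpa using he
  | succ n ih =>
    simp_rw [Finset.sum_range_succ _ (n + 1)]
    refine (ih.add (((hasDerivAt_pow (n + 1) x).mul he).const_mul
      (((n + 1).factorial : ℝ)⁻¹))).congr_deriv ?_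
    have h1 : ((n + 1).factorial : ℝ) = (n + 1) * n.factorial := by
      rw [Nat.factorial_succ]; push_cast; ring
    have h2 : (n.factorial : ℝ) ≠ 0 := by positivity
    have h3 : (n : ℝ) + 1 ≠ 0 := by positivity
    rw [h1]
    simp only [Nat.add_sub_cancel]
    push_cast
    field_simp
    ring

/-- Minus the finite sum is an antiderivative of the density and vanishes at infinity. This is where
an integer shape matters. -/
lemma gammaMeasure_Ioi {k : ℕ} (hk : 1 ≤ k) {r : ℝ} (hr : 0 < r) {w : ℝ} (hw : 0 ≤ w) :
    gammaMeasure k r (Set.Ioi w) = ENNReal.ofReal (∑ i ∈ Finset.range k,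
      (i.factorial : ℝ)⁻¹ * ((r * w) ^ i * Real.exp (-(r * w)))) := by
  obtain ⟨n, rfl⟩ : ∃ n, k = n + 1 := ⟨k - 1, by omega⟩
  set Q : ℝ → ℝ := fun x => ∑ i ∈ Finset.range (n + 1), (i.factorial : ℝ)⁻¹ *
    (x ^ i * Real.exp (-x)) with hQ
  set g : ℝ → ℝ := fun x => (n.factorial : ℝ)⁻¹ * ((r * x) ^ n * Real.exp (-(r * x))) * r with hg
  have hderiv : ∀ x ∈ Set.Ioi w, HasDerivAt (fun x => -Q (r * x)) (g x) x := by
    intro x _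
    have h1 := (hasDerivAt_sum_pow_mul_exp_neg n (r * x)).comp x ((hasDerivAt_id x).const_mul r)
    refine h1.fun_neg.congr_deriv ?_
    simp only [hg]; ring
  have hcont : Continuous fun x => -Q (r * x) := by
    rw [hQ]; fun_prop
  have hg0 : ∀ x ∈ Set.Ioi w, 0 ≤ g x := by
    intro x hx
    have : 0 < x := hw.trans_lt hx
    rw [hg]; positivity
  have hQlim : Tendsto Q atTop (𝓝 0) := by
    have h := tendsto_finsetSum (Finset.range (n + 1)) fun i _ =>
      (Real.tendsto_pow_mul_exp_neg_atTop_nhds_zero i).const_mul ((i.factorial : ℝ)⁻¹)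
    simpa using h
  have hlim : Tendsto (fun x => -Q (r * x)) atTop (𝓝 0) := by
    simpa using (hQlim.comp (tendsto_id.const_mul_atTop hr)).neg
  have hint := integrableOn_Ioi_deriv_of_nonneg hcont.continuousWithinAt hderiv hg0 hlim
  have hval := integral_Ioi_of_hasDerivAt_of_nonneg hcont.continuousWithinAt hderiv hg0 hlim
  rw [gammaMeasure, withDensity_apply _ measurableSet_Ioi]
  have hpdf : ∀ x ∈ Set.Ioi w, gammaPDF ((n + 1 : ℕ) : ℝ) r x = ENNReal.ofReal (g x) := by
    intro x hx
    have hx0 : 0 < x := hw.trans_lt hx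
    rw [gammaPDF_of_nonneg hx0.le]
    congr 1
    have h1 : ((n + 1 : ℕ) : ℝ) - 1 = n := by push_cast; ring
    have h2 : Real.Gamma ((n + 1 : ℕ) : ℝ) = n.factorial := by
      push_cast; exact Real.Gamma_nat_eq_factorial n
    rw [h1, h2, Real.rpow_natCast, Real.rpow_natCast]
    simp only [hg, mul_pow, pow_succ]
    ring
  rw [setLIntegral_congr_fun measurableSet_Ioi hpdf,
    ← ofReal_integral_eq_lintegral_ofReal hint
      ((ae_restrict_mem measurableSet_Ioi).mono fun x hx => hg0 x hx), hval]
  congr 1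
  ring

lemma gammaMeasure_lt_ofReal {k : ℕ} (hk : 1 ≤ k) {r : ℝ} (hr : 0 < r) (V : ℝ≥0∞) :
    gammaMeasure k r {x | V < ENNReal.ofReal x} = gammaTail k (ENNReal.ofReal r * V) := by
  by_cases hV : V = ∞
  · subst hV
    have h1 : {x : ℝ | ∞ < ENNReal.ofReal x} = ∅ := by ext; simp
    rw [h1, measure_empty, ENNReal.mul_top (by simpa using hr), gammaTail]
    simp [nexp_top]
  · have h1 : {x : ℝ | V < ENNReal.ofReal x} = Set.Ioi V.toReal := by
      ext x
      exact ENNReal.lt_ofReal_iff_toReal_lt hV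
    have hv : 0 ≤ V.toReal := ENNReal.toReal_nonneg
    rw [h1, gammaMeasure_Ioi hk hr hv, gammaTail,
      ENNReal.ofReal_sum_of_nonneg (fun i _ => by positivity)]
    refine Finset.sum_congr rfl fun i _ => ?_
    have h2 : ENNReal.ofReal r * V = ENNReal.ofReal (r * V.toReal) := by
      rw [ENNReal.ofReal_mul hr.le, ENNReal.ofReal_toReal hV]
    rw [h2, nexp_ofReal (by positivity), ← ENNReal.ofReal_pow (by positivity),
      ← ENNReal.ofReal_mul (by positivity), ← ENNReal.ofReal_mul (by positivity)]

lemma expMeasure_lt_ofReal (V : ℝ≥0∞) :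
    expMeasure 1 {x | V < ENNReal.ofReal x} = nexp V := by
  have := gammaMeasure_lt_ofReal le_rfl one_pos V
  rwa [gammaTail_one, ENNReal.ofReal_one, one_mul, Nat.cast_one] at this

lemma lintegral_nexp_expMeasure {t : ℝ} (ht : 0 ≤ t) :
    ∫⁻ x, nexp (ENNReal.ofReal (t * x)) ∂(expMeasure 1) = ENNReal.ofReal (1 + t)⁻¹ := by
  have hm : Measurable fun x : ℝ => nexp (ENNReal.ofReal (t * x)) :=
    measurable_nexp.comp (ENNReal.measurable_ofReal.comp (measurable_id.const_mul t))
  have hpm : ∀ r : ℝ, Measurable (exponentialPDF r) := fun r =>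
    ENNReal.measurable_ofReal.comp (measurable_exponentialPDFReal r)
  have h1t : 0 < 1 + t := by linarith
  have h0 : expMeasure 1 = volume.withDensity (exponentialPDF 1) := rfl
  rw [h0, lintegral_withDensity_eq_lintegral_mul _ (hpm 1) hm]
  -- Exponential tilting: the product is a multiple of the exponential density of rate `1 + t`,
  -- whose total mass is `1`.
  have h1 : ∀ x, (exponentialPDF 1 * fun x : ℝ => nexp (ENNReal.ofReal (t * x))) x =
      ENNReal.ofReal (1 + t)⁻¹ * exponentialPDF (1 + t) x := by
    intro x
    rw [Pi.mul_apply]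
    rcases lt_or_ge x 0 with hx | hx
    · rw [exponentialPDF_of_neg hx, exponentialPDF_of_neg hx, zero_mul, mul_zero]
    · rw [exponentialPDF_of_nonneg hx, exponentialPDF_of_nonneg hx,
        nexp_ofReal (by positivity), ← ENNReal.ofReal_mul (by positivity),
        ← ENNReal.ofReal_mul (by positivity), ← mul_assoc, inv_mul_cancel₀ h1t.ne', one_mul,
        one_mul, ← Real.exp_add, one_mul]
      exact congrArg ENNReal.ofReal (congrArg Real.exp (by ring))
  simp_rw [h1]
  rw [lintegral_const_mul _ (hpm _), lintegral_exponentialPDF_eq_one h1t, mul_one]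

/-! ### Derivatives of a Laplace transform -/

/-- The Laplace transform at `s` is the moment generating function at `-s`, which can be
differentiated under the integral inside its domain. The nonnegativity is recorded because
`ENNReal.ofReal` would hide a negative value. -/
lemma lintegral_pow_mul_nexp {Ω : Type*} [MeasurableSpace Ω] {μ : Measure Ω} [IsFiniteMeasure μ]
    {Y : Ω → ℝ≥0∞} (hY : Measurable Y) {L : ℝ → ℝ} (hL0 : ∀ s, 0 < s → 0 ≤ L s)
    (hL : ∀ s, 0 < s → ∫⁻ ω, nexp (ENNReal.ofReal s * Y ω) ∂μ = ENNReal.ofReal (L s)) (i : ℕ) :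
    0 ≤ (-1) ^ i * iteratedDeriv i L 1 ∧
    ∫⁻ ω, Y ω ^ i * nexp (Y ω) ∂μ = ENNReal.ofReal ((-1) ^ i * iteratedDeriv i L 1) := by
  -- Where `Y = ∞` all integrands are `0`, so everything reduces to a real variable on `A`.
  set A : Set Ω := {ω | Y ω ≠ ∞} with hA
  have hAm : MeasurableSet A := (hY (measurableSet_singleton ∞)).compl
  set ν := μ.restrict A with hν
  set X : Ω → ℝ := fun ω => (Y ω).toReal with hX
  have hXm : Measurable X := hY.ennreal_toReal
  have hX0 : ∀ ω, 0 ≤ X ω := fun ω => ENNReal.toReal_nonneg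
  have hexp : ∀ s : ℝ, 0 ≤ s → Integrable (fun ω => Real.exp (-s * X ω)) ν := by
    intro s hs
    refine Integrable.of_bound (by fun_prop) 1 (ae_of_all _ fun ω => ?_)
    rw [Real.norm_of_nonneg (Real.exp_pos _).le, Real.exp_le_one_iff]
    nlinarith [hX0 ω]
  have hsub : Set.Iic (0 : ℝ) ⊆ integrableExpSet X ν := fun t ht => by
    have := hexp (-t) (neg_nonneg.2 ht)
    rwa [neg_neg] at this
  have hint : (-1 : ℝ) ∈ interior (integrableExpSet X ν) :=
    interior_mono hsub (by rw [interior_Iic]; norm_num)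
  have hmgf : ∀ s, 0 < s → mgf X ν (-s) = L s := by
    intro s hs
    have h1 : ∫⁻ ω, nexp (ENNReal.ofReal s * Y ω) ∂μ =
        ∫⁻ ω, ENNReal.ofReal (Real.exp (-s * X ω)) ∂ν := by
      rw [← lintegral_add_compl _ hAm]
      have h2 : ∫⁻ ω in Aᶜ, nexp (ENNReal.ofReal s * Y ω) ∂μ = 0 := by
        rw [setLIntegral_congr_fun (g := fun _ => 0) hAm.compl, lintegral_zero]
        intro ω hω
        have : Y ω = ∞ := not_not.1 hω
        simp only [this]
        rw [ENNReal.mul_top (by simpa using hs), nexp_top]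
      rw [h2, add_zero]
      refine setLIntegral_congr_fun hAm fun ω hω => ?_
      have h3 : ENNReal.ofReal s * Y ω = ENNReal.ofReal (s * X ω) := by
        rw [ENNReal.ofReal_mul hs.le, hX, ENNReal.ofReal_toReal hω]
      simp only [h3]
      rw [nexp_ofReal (mul_nonneg hs.le (hX0 ω)), neg_mul]
    rw [hL s hs, ← ofReal_integral_eq_lintegral_ofReal (hexp s hs.le)
      (ae_of_all _ fun ω => (Real.exp_pos _).le)] at h1
    rw [mgf]
    exact ((ENNReal.ofReal_eq_ofReal_iff (hL0 s hs)
      (integral_nonneg fun ω => (Real.exp_pos _).le)).1 h1).symm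
  have hev : L =ᶠ[𝓝 1] fun s => mgf X ν (-s) := by
    filter_upwards [lt_mem_nhds (zero_lt_one' ℝ)] with s hs
    exact (hmgf s hs).symm
  have hval : (-1) ^ i * iteratedDeriv i L 1 = ∫ ω, X ω ^ i * Real.exp (-1 * X ω) ∂ν := by
    rw [hev.iteratedDeriv_eq, iteratedDeriv_comp_neg, iteratedDeriv_mgf hint, smul_eq_mul,
      ← mul_assoc, ← mul_pow]
    simp
  have hnn : ∀ ω, 0 ≤ X ω ^ i * Real.exp (-1 * X ω) := fun ω =>
    mul_nonneg (pow_nonneg (hX0 ω) i) (Real.exp_pos _).le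
  rw [hval]
  refine ⟨integral_nonneg hnn, ?_⟩
  rw [ofReal_integral_eq_lintegral_ofReal
    (integrable_pow_mul_exp_of_mem_interior_integrableExpSet hint i) (ae_of_all _ hnn),
    ← lintegral_add_compl _ hAm]
  have h2 : ∫⁻ ω in Aᶜ, Y ω ^ i * nexp (Y ω) ∂μ = 0 := by
    rw [setLIntegral_congr_fun (g := fun _ => 0) hAm.compl, lintegral_zero]
    intro ω hω
    have : Y ω = ∞ := not_not.1 hω
    simp only [this]
    rw [nexp_top, mul_zero]
  rw [h2, add_zero]
  refine setLIntegral_congr_fun hAm fun ω hω => ?_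
  have h3 : Y ω = ENNReal.ofReal (X ω) := (ENNReal.ofReal_toReal hω).symm
  simp only [h3]
  rw [nexp_ofReal (hX0 ω), ← ENNReal.ofReal_pow (hX0 ω),
    ← ENNReal.ofReal_mul (pow_nonneg (hX0 ω) i), neg_one_mul]

/-! ### Integrals over independent marks -/

section InfiniteProduct

variable {E : Type*} [MeasurableSpace E] {ν : Measure E} [IsProbabilityMeasure ν]

/-- Independence handles finite products and dominated convergence passes to the limit. Writing the
means as `nexp (g j)` turns the infinite product into a sum in `[0, ∞]`, which always converges. -/
lemma lintegral_nexp_tsum_infinitePi {f : ℕ → E → ℝ≥0∞} (hf : ∀ j, Measurable (f j))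
    {g : ℕ → ℝ≥0∞} (hg : ∀ j, ∫⁻ y, nexp (f j y) ∂ν = nexp (g j)) :
    ∫⁻ m, nexp (∑' j, f j (m j)) ∂(Measure.infinitePi fun _ : ℕ => ν) = nexp (∑' j, g j) := by
  have hm : ∀ j, Measurable fun y => nexp (f j y) := fun j => measurable_nexp.comp (hf j)
  have hind := iIndepFun_infinitePi (P := fun _ : ℕ => ν) (X := fun j y => nexp (f j y)) hm
  have hfin : ∀ n, ∫⁻ m, ∏ j ∈ Finset.range n, nexp (f j (m j))
      ∂(Measure.infinitePi fun _ : ℕ => ν) = ∏ j ∈ Finset.range n, nexp (g j) := by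
    intro n
    rw [lintegral_prod_eq_prod_lintegral_of_indepFun _ _ hind
      (fun j => (hm j).comp (measurable_pi_apply j))]
    refine Finset.prod_congr rfl fun j _ => ?_
    rw [← hg j]
    exact (measurePreserving_eval_infinitePi (fun _ : ℕ => ν) j).lintegral_comp (hm j)
  have h1 : Tendsto (fun n => ∫⁻ m, ∏ j ∈ Finset.range n, nexp (f j (m j))
      ∂(Measure.infinitePi fun _ : ℕ => ν)) atTop
      (𝓝 (∫⁻ m, nexp (∑' j, f j (m j)) ∂(Measure.infinitePi fun _ : ℕ => ν))) := by
    refine tendsto_lintegral_of_dominated_convergence (fun _ => 1) (fun n => ?_) (fun n => ?_)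
      (by simp) (ae_of_all _ fun m => tendsto_nexp_sum_range _)
    · exact Finset.measurable_fun_prod _ fun j _ => (hm j).comp (measurable_pi_apply j)
    · exact ae_of_all _ fun m => Finset.prod_le_one' fun j _ => nexp_le_one _
  simp_rw [hfin] at h1
  exact tendsto_nhds_unique h1 (tendsto_nexp_sum_range g)

/-- Isolated so that it also applies to the σ-algebra generated by all coordinates but one. -/
lemma measurable_const_mul_tsum {Ω : Type*} [MeasurableSpace Ω] {g : ℕ → Ω → ℝ≥0∞}
    (hg : ∀ j, Measurable (g j)) (c : ℝ≥0∞) : Measurable fun m => c * ∑' j, g j m :=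
  (Measurable.tsum hg).const_mul c

/-- A coordinate of an infinite product is independent of a sum over the other coordinates. -/
lemma infinitePi_tsum_lt {f : ℕ → E → ℝ≥0∞} (hf : ∀ j, Measurable (f j)) (c : ℝ≥0∞)
    {σ : E → ℝ≥0∞} (hσ : Measurable σ) (k : ℕ) :
    (Measure.infinitePi fun _ : ℕ => ν)
        {m | c * (∑' j, if j = k then 0 else f j (m j)) < σ (m k)} =
      ∫⁻ m, ν {y | c * (∑' j, if j = k then 0 else f j (m j)) < σ y}
        ∂(Measure.infinitePi fun _ : ℕ => ν) := by
  set M := Measure.infinitePi fun _ : ℕ => ν with hM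
  set V : (ℕ → E) → ℝ≥0∞ := fun m => c * (∑' j, if j = k then 0 else f j (m j)) with hV
  have hind := iIndepFun_infinitePi (P := fun _ : ℕ => ν) (X := fun _ y => y)
    (fun _ => measurable_id)
  have hind2 := indep_iSup_of_disjoint (fun j => (measurable_pi_apply j).comap_le) hind
    (S := {k}ᶜ) (T := {k}) disjoint_compl_left
  have hVm' : Measurable[⨆ j ∈ ({k}ᶜ : Set ℕ),
      MeasurableSpace.comap (fun m : ℕ → E => m j) inferInstance] V := by
    refine @measurable_const_mul_tsum _ (⨆ j ∈ ({k}ᶜ : Set ℕ),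
      MeasurableSpace.comap (fun m : ℕ → E => m j) inferInstance) _ (fun j => ?_) c
    by_cases hj : j = k
    · simp only [hj, if_true]; exact @measurable_const _ _ _ (_) _
    · simp only [hj, if_false]
      have h1 : Measurable[MeasurableSpace.comap (fun m : ℕ → E => m j) inferInstance]
          (fun m : ℕ → E => f j (m j)) := (hf j).comp (comap_measurable fun m : ℕ → E => m j)
      exact h1.mono (le_iSup₂_of_le j hj le_rfl) le_rfl
  have hVm : Measurable V := by
    refine measurable_const_mul_tsum (fun j => ?_) c
    by_cases hj : j = k
    · simp only [hj, if_true]; exact measurable_const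
    · simp only [hj, if_false]
      exact (hf j).comp (measurable_pi_apply j)
  have hIF : IndepFun V (fun m : ℕ → E => m k) M := by
    refine indep_of_indep_of_le_left (indep_of_indep_of_le_right hind2 ?_) hVm'.comap_le
    exact le_iSup₂_of_le k rfl le_rfl
  have hmap := (indepFun_iff_map_prod_eq_prod_map_map hVm.aemeasurable
    (measurable_pi_apply k).aemeasurable).1 hIF
  have hk : M.map (fun m : ℕ → E => m k) = ν := Measure.infinitePi_map_eval _ k
  rw [hk] at hmap
  have hS : MeasurableSet {z : ℝ≥0∞ × E | z.1 < σ z.2} :=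
    measurableSet_lt measurable_fst (hσ.comp measurable_snd)
  have h1 : {m : ℕ → E | V m < σ (m k)} =
      (fun m : ℕ → E => (V m, m k)) ⁻¹' {z : ℝ≥0∞ × E | z.1 < σ z.2} := rfl
  change M {m : ℕ → E | V m < σ (m k)} = _
  rw [h1, ← Measure.map_apply (hVm.prodMk (measurable_pi_apply k)) hS, hmap,
    Measure.prod_apply hS, lintegral_map (measurable_measure_prodMk_left hS) hVm]
  rfl

end InfiniteProduct

/-! ### The law of the marks -/

namespace RISParams

variable {P : RISParams}

/-- The law of the powers of a transmitter, without the indicator of a RIS. -/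
noncomputable def powerLaw (P : RISParams) : Measure (ℝ × ℝ × ℝ × ℝ) :=
  (gammaMeasure P.kappaHat (1 / P.chiBar)).prod
    ((expMeasure 1).prod ((expMeasure 1).prod (expMeasure 1)))

instance : IsProbabilityMeasure (expMeasure 1) := isProbabilityMeasure_expMeasure one_pos

lemma Admissible.isProbabilityMeasure_gamma (hP : P.Admissible) :
    IsProbabilityMeasure (gammaMeasure P.kappaHat (1 / P.chiBar)) :=
  isProbabilityMeasure_gammaMeasure (by exact_mod_cast P.one_le_kappaHat)
    (one_div_pos.2 hP.chiBar_pos)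

lemma Admissible.isProbabilityMeasure_powerLaw (hP : P.Admissible) :
    IsProbabilityMeasure P.powerLaw := by
  have := hP.isProbabilityMeasure_gamma
  unfold powerLaw
  infer_instance

lemma Admissible.isProbabilityMeasure_markLaw (hP : P.Admissible) :
    IsProbabilityMeasure P.markLaw := by
  have := hP.isProbabilityMeasure_gamma
  unfold markLaw
  infer_instance

lemma Admissible.lintegral_markLaw (hP : P.Admissible) {f : Bool × ℝ × ℝ × ℝ × ℝ → ℝ≥0∞}
    (hf : Measurable f) :
    ∫⁻ m, f m ∂P.markLaw = ENNReal.ofReal P.p * ∫⁻ y, f (true, y) ∂P.powerLaw +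
      ENNReal.ofReal (1 - P.p) * ∫⁻ y, f (false, y) ∂P.powerLaw := by
  have := hP.isProbabilityMeasure_powerLaw
  change ∫⁻ m, f m ∂((bernoulliMeasure true false P.p).prod P.powerLaw) = _
  rw [lintegral_prod _ hf.aemeasurable, bernoulliMeasure_def, lintegral_add_measure,
    lintegral_smul_measure, lintegral_smul_measure, lintegral_dirac, lintegral_dirac]
  have h1 : ((unitInterval.toNNReal P.p : ℝ≥0) : ℝ≥0∞) = ENNReal.ofReal P.p := by
    rw [ENNReal.ofReal_eq_coe_nnreal P.p.2.1]; rfl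
  have h2 : ((unitInterval.toNNReal (unitInterval.symm P.p) : ℝ≥0) : ℝ≥0∞) =
      ENNReal.ofReal (1 - P.p) := by
    rw [ENNReal.ofReal_eq_coe_nnreal (sub_nonneg.2 P.p.2.2)]; rfl
  rw [← h1, ← h2]
  rfl

/-- Mean of `e^{-·}` of the power of an interferer. -/
lemma Admissible.lintegral_nexp_interferer (hP : P.Admissible) {c₁ c₂ : ℝ} (h₁ : 0 ≤ c₁)
    (h₂ : 0 ≤ c₂) :
    ∫⁻ m, nexp (ENNReal.ofReal (if m.1 then c₁ * m.2.2.2.1 else c₂ * m.2.2.2.2)) ∂P.markLaw =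
      ENNReal.ofReal (P.p * (1 + c₁)⁻¹ + (1 - P.p) * (1 + c₂)⁻¹) := by
  have := hP.isProbabilityMeasure_gamma
  have hm : ∀ c : ℝ, Measurable fun x : ℝ => nexp (ENNReal.ofReal (c * x)) := fun c =>
    measurable_nexp.comp (ENNReal.measurable_ofReal.comp (measurable_id.const_mul c))
  have hmeas : Measurable fun m : Bool × ℝ × ℝ × ℝ × ℝ =>
      nexp (ENNReal.ofReal (if m.1 then c₁ * m.2.2.2.1 else c₂ * m.2.2.2.2)) := by
    refine measurable_nexp.comp (ENNReal.measurable_ofReal.comp (Measurable.ite ?_ ?_ ?_))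
    · exact measurable_fst (MeasurableSet.of_discrete (s := {true}))
    · fun_prop
    · fun_prop
  rw [hP.lintegral_markLaw hmeas]
  simp only [if_true, Bool.false_eq_true, if_false]
  have e1 : ∫⁻ y, nexp (ENNReal.ofReal (c₁ * y.2.2.1)) ∂P.powerLaw =
      ENNReal.ofReal (1 + c₁)⁻¹ := by
    have mp : MeasurePreserving (fun y : ℝ × ℝ × ℝ × ℝ => y.2.2.1) P.powerLaw (expMeasure 1) :=
      measurePreserving_fst.comp (measurePreserving_snd.comp measurePreserving_snd)
    rw [← lintegral_nexp_expMeasure h₁]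
    exact mp.lintegral_comp (hm c₁)
  have e2 : ∫⁻ y, nexp (ENNReal.ofReal (c₂ * y.2.2.2)) ∂P.powerLaw =
      ENNReal.ofReal (1 + c₂)⁻¹ := by
    have mp : MeasurePreserving (fun y : ℝ × ℝ × ℝ × ℝ => y.2.2.2) P.powerLaw (expMeasure 1) :=
      measurePreserving_snd.comp (measurePreserving_snd.comp measurePreserving_snd)
    rw [← lintegral_nexp_expMeasure h₂]
    exact mp.lintegral_comp (hm c₂)
  have hp := P.p.2.1
  have hp' := sub_nonneg.2 P.p.2.2
  rw [e1, e2, ← ENNReal.ofReal_mul hp, ← ENNReal.ofReal_mul hp',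
    ← ENNReal.ofReal_add (by positivity) (by positivity)]

/-- Tail of the normalized power of the serving transmitter. -/
lemma Admissible.markLaw_lt_signal (hP : P.Admissible) (V : ℝ≥0∞) :
    P.markLaw {m | V < ENNReal.ofReal (if m.1 then m.2.1 else m.2.2.1)} =
      ENNReal.ofReal P.p * gammaTail P.kappaHat (ENNReal.ofReal (1 / P.chiBar) * V) +
        ENNReal.ofReal (1 - P.p) * nexp V := by
  have := hP.isProbabilityMeasure_gamma
  have hS : MeasurableSet {m : Bool × ℝ × ℝ × ℝ × ℝ |
      V < ENNReal.ofReal (if m.1 then m.2.1 else m.2.2.1)} := by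
    refine measurableSet_lt measurable_const (ENNReal.measurable_ofReal.comp
      (Measurable.ite ?_ ?_ ?_))
    · exact measurable_fst (MeasurableSet.of_discrete (s := {true}))
    · fun_prop
    · fun_prop
  rw [← lintegral_indicator_one hS, hP.lintegral_markLaw (measurable_one.indicator hS)]
  have hR : MeasurableSet {x : ℝ | V < ENNReal.ofReal x} :=
    measurableSet_lt measurable_const ENNReal.measurable_ofReal
  have hRm : Measurable ({x : ℝ | V < ENNReal.ofReal x}.indicator (1 : ℝ → ℝ≥0∞)) :=
    measurable_one.indicator hR
  congr 2
  · have mp : MeasurePreserving (fun y : ℝ × ℝ × ℝ × ℝ => y.1) P.powerLaw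
        (gammaMeasure P.kappaHat (1 / P.chiBar)) := measurePreserving_fst
    rw [← gammaMeasure_lt_ofReal P.one_le_kappaHat (one_div_pos.2 hP.chiBar_pos),
      ← lintegral_indicator_one hR]
    exact mp.lintegral_comp hRm
  · have mp : MeasurePreserving (fun y : ℝ × ℝ × ℝ × ℝ => y.2.1) P.powerLaw (expMeasure 1) :=
      measurePreserving_fst.comp measurePreserving_snd
    rw [← expMeasure_lt_ofReal, ← lintegral_indicator_one hR]
    exact mp.lintegral_comp hRm

end RISParams

/-! ### The mean factor contributed by one interferer -/

section MeanFactor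

/-- `E[e^{-power}]` for an interferer at relative squared distance `u`. -/
noncomputable def meanFactor (p x₁ x₂ a u : ℝ) : ℝ :=
  p * (1 + x₁ * u ^ (-a))⁻¹ + (1 - p) * (1 + x₂ * u ^ (-a))⁻¹

/-- `-log` of the mean factor. -/
noncomputable def logFactor (p x₁ x₂ a u : ℝ) : ℝ≥0∞ :=
  ENNReal.ofReal (-Real.log (meanFactor p x₁ x₂ a u))

variable {p x₁ x₂ a : ℝ}

lemma inv_one_add_le_one {y : ℝ} (hy : 0 ≤ y) : (1 + y)⁻¹ ≤ 1 := inv_le_one_of_one_le₀ (by linarith)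

lemma meanFactor_pos (hp : p ∈ Set.Icc (0 : ℝ) 1) (h₁ : 0 ≤ x₁) (h₂ : 0 ≤ x₂) {u : ℝ}
    (hu : 0 < u) : 0 < meanFactor p x₁ x₂ a u := by
  have hr : 0 < u ^ (-a) := Real.rpow_pos_of_pos hu _
  have e1 : 0 < (1 + x₁ * u ^ (-a))⁻¹ := by positivity
  have e2 : 0 < (1 + x₂ * u ^ (-a))⁻¹ := by positivity
  have hp' := sub_nonneg.2 hp.2
  rcases hp.1.eq_or_lt with h | h
  · rw [meanFactor, ← h]; simpa using e2
  · exact add_pos_of_pos_of_nonneg (mul_pos h e1) (mul_nonneg hp' e2.le)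

lemma meanFactor_le_one (hp : p ∈ Set.Icc (0 : ℝ) 1) (h₁ : 0 ≤ x₁) (h₂ : 0 ≤ x₂) {u : ℝ}
    (hu : 0 < u) : meanFactor p x₁ x₂ a u ≤ 1 := by
  have hr : 0 < u ^ (-a) := Real.rpow_pos_of_pos hu _
  have e1 := mul_le_of_le_one_right hp.1 (inv_one_add_le_one (mul_nonneg h₁ hr.le))
  have e2 := mul_le_of_le_one_right (sub_nonneg.2 hp.2)
    (inv_one_add_le_one (mul_nonneg h₂ hr.le))
  unfold meanFactor
  linarith

lemma nexp_logFactor (hp : p ∈ Set.Icc (0 : ℝ) 1) (h₁ : 0 ≤ x₁) (h₂ : 0 ≤ x₂) {u : ℝ}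
    (hu : 0 < u) : nexp (logFactor p x₁ x₂ a u) = ENNReal.ofReal (meanFactor p x₁ x₂ a u) := by
  have hpos := meanFactor_pos (a := a) hp h₁ h₂ hu
  rw [logFactor, nexp_ofReal, neg_neg, Real.exp_log hpos]
  exact neg_nonneg.2 (Real.log_nonpos hpos.le (meanFactor_le_one hp h₁ h₂ hu))

lemma measurable_logFactor : Measurable (logFactor p x₁ x₂ a) := by
  unfold logFactor meanFactor
  fun_prop

/-- A farther interferer weighs less. This is the monotonicity required by the grid argument. -/
lemma antitoneOn_logFactor (hp : p ∈ Set.Icc (0 : ℝ) 1) (h₁ : 0 ≤ x₁) (h₂ : 0 ≤ x₂)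
    (ha : 0 ≤ a) : AntitoneOn (logFactor p x₁ x₂ a) (Set.Ioi 0) := by
  intro u hu v hv huv
  refine ENNReal.ofReal_le_ofReal (neg_le_neg (Real.log_le_log (meanFactor_pos hp h₁ h₂ hu) ?_))
  have hr : v ^ (-a) ≤ u ^ (-a) := Real.rpow_le_rpow_of_nonpos hu huv (by linarith)
  have hv0 : 0 < v ^ (-a) := Real.rpow_pos_of_pos hv _
  have hp' := sub_nonneg.2 hp.2
  have hp0 := hp.1
  unfold meanFactor
  gcongr

/-- The identity `1 - (1 + x u^{-a})⁻¹ = x (u^a + x)⁻¹` brings `J` into the form of the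
hypergeometric integral. -/
lemma lintegral_one_sub_nexp_logFactor (hp : p ∈ Set.Icc (0 : ℝ) 1) (h₁ : 0 ≤ x₁) (h₂ : 0 ≤ x₂)
    (ha : 1 < a) :
    ∫⁻ v in Set.Ici (1 : ℝ), (1 - nexp (logFactor p x₁ x₂ a v)) =
      ENNReal.ofReal (p * (∫ u in Set.Ioi (1 : ℝ), x₁ * (u ^ a + x₁)⁻¹) +
        (1 - p) * ∫ u in Set.Ioi (1 : ℝ), x₂ * (u ^ a + x₂)⁻¹) := by
  have hp' := sub_nonneg.2 hp.2
  have hint : ∀ x : ℝ, 0 ≤ x →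
      IntegrableOn (fun u : ℝ => x * (u ^ a + x)⁻¹) (Set.Ioi 1) := by
    intro x hx
    have h := (integrableOn_inv_rpow_sub ha (show -x < 1 by linarith)).const_mul x
    simp only [sub_neg_eq_add] at h
    exact h
  have heq : ∀ x : ℝ, 0 ≤ x → ∀ u ∈ Set.Ioi (1 : ℝ),
      1 - (1 + x * u ^ (-a))⁻¹ = x * (u ^ a + x)⁻¹ := by
    intro x hx u hu
    have hu0 : 0 < u := one_pos.trans hu
    have hr : 0 < u ^ a := Real.rpow_pos_of_pos hu0 _
    rw [Real.rpow_neg hu0.le]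
    have h3 : u ^ a + x ≠ 0 := by positivity
    field_simp
    ring
  have hsum : Integrable (fun u : ℝ => p * (x₁ * (u ^ a + x₁)⁻¹) +
      (1 - p) * (x₂ * (u ^ a + x₂)⁻¹)) (volume.restrict (Set.Ioi 1)) :=
    ((hint x₁ h₁).const_mul p).add ((hint x₂ h₂).const_mul (1 - p))
  rw [← setLIntegral_congr Ioi_ae_eq_Ici, ← integral_const_mul, ← integral_const_mul,
    ← integral_add ((hint x₁ h₁).const_mul p) ((hint x₂ h₂).const_mul (1 - p)),
    ofReal_integral_eq_lintegral_ofReal hsum]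
  · refine setLIntegral_congr_fun measurableSet_Ioi fun u hu => ?_
    have hu0 : 0 < u := one_pos.trans hu
    rw [nexp_logFactor hp h₁ h₂ hu0, ← ENNReal.ofReal_one,
      ← ENNReal.ofReal_sub _ (meanFactor_pos hp h₁ h₂ hu0).le, ← heq x₁ h₁ u hu,
      ← heq x₂ h₂ u hu, meanFactor]
    congr 1; ring
  · refine (ae_restrict_mem measurableSet_Ioi).mono fun u hu => ?_
    have hu0 : 0 < u := one_pos.trans hu
    have hr : 0 < u ^ a := Real.rpow_pos_of_pos hu0 _
    have hp0 := hp.1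
    simp only [Pi.zero_apply]
    positivity

end MeanFactor

/-! ### Squared distances of a planar Poisson process -/

section SquaredDistance

variable {lam : ℝ}

/-- The mean number of points closer to the origin than `x`. -/
noncomputable def discCount (lam : ℝ) (x : Plane) : ℝ := lam * Real.pi * ‖x‖ ^ 2

lemma measurable_discCount (lam : ℝ) : Measurable (discCount lam) := by
  unfold discCount; fun_prop

lemma discCount_nonneg (hlam : 0 < lam) (x : Plane) : 0 ≤ discCount lam x := by
  unfold discCount; positivity

lemma discCount_le_iff (hlam : 0 < lam) {x y : Plane} :
    discCount lam x ≤ discCount lam y ↔ ‖x‖ ≤ ‖y‖ := by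
  unfold discCount
  rw [mul_le_mul_iff_right₀ (by positivity), sq_le_sq₀ (norm_nonneg _) (norm_nonneg _)]

lemma map_discCount_Iio (hlam : 0 < lam) (b : ℝ) :
    ((ENNReal.ofReal lam • volume).map (discCount lam)) (Set.Iio b) = ENNReal.ofReal b := by
  have hc : 0 < lam * Real.pi := by positivity
  rw [Measure.map_apply (measurable_discCount lam) measurableSet_Iio, Measure.smul_apply,
    smul_eq_mul]
  rcases le_or_gt b 0 with hb | hb
  · have h : discCount lam ⁻¹' Set.Iio b = ∅ := by
      refine Set.eq_empty_of_forall_notMem fun x hx => ?_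
      exact absurd (lt_of_lt_of_le hx hb) (not_lt.2 (discCount_nonneg hlam x))
    rw [h, measure_empty, mul_zero, ENNReal.ofReal_of_nonpos hb]
  · have h : discCount lam ⁻¹' Set.Iio b = Metric.ball (0 : Plane) (√(b / (lam * Real.pi))) := by
      ext x
      rw [Set.mem_preimage, Set.mem_Iio, mem_ball_zero_iff, Real.lt_sqrt (norm_nonneg _),
        lt_div_iff₀ hc, discCount, mul_comm]
    rw [h, EuclideanSpace.volume_ball_fin_two, ← ENNReal.ofReal_pow (Real.sqrt_nonneg _),
      Real.sq_sqrt (by positivity), ← ENNReal.ofReal_mul (by positivity),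
      ← ENNReal.ofReal_mul hlam.le]
    congr 1
    field_simp

/-- Disc areas grow with the square of the radius, so both measures give `[0, b)` mass `b`;
half-open intervals determine them. -/
lemma map_discCount (hlam : 0 < lam) :
    (ENNReal.ofReal lam • volume).map (discCount lam) = volume.restrict (Set.Ici 0) := by
  have hIco : ∀ (ν : Measure ℝ), (∀ b, ν (Set.Iio b) = ENNReal.ofReal b) → ∀ a b : ℝ, a < b →
      ν (Set.Ico a b) = ENNReal.ofReal b - ENNReal.ofReal a := by
    intro ν hν a b hab
    have h : Set.Ico a b = Set.Iio b \ Set.Iio a := by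
      ext x; simp
    rw [h, measure_sdiff (Set.Iio_subset_Iio hab.le) measurableSet_Iio.nullMeasurableSet
      (by rw [hν]; exact ENNReal.ofReal_ne_top), hν, hν]
  have h1 := hIco _ (map_discCount_Iio hlam)
  have h2 := hIco (volume.restrict (Set.Ici 0)) volume_restrict_Iio
  refine Measure.ext_of_Ico' _ _ (fun a b hab => ?_) (fun a b hab => ?_)
  · rw [h1 a b hab]
    exact ENNReal.sub_ne_top ENNReal.ofReal_ne_top
  · rw [h1 a b hab, h2 a b hab]

lemma IsPoissonProcess.discCount {Ω : Type*} [MeasurableSpace Ω] {μ : Measure Ω}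
    {X : ℕ → Ω → Plane} (hX : IsPoissonProcess μ X lam) (hlam : 0 < lam) :
    IsPoissonWithIntensity μ (fun k ω => discCount lam (X k ω)) (volume.restrict (Set.Ici 0)) := by
  rw [← map_discCount hlam]
  exact (hX.isPoissonWithIntensity hlam).map (measurable_discCount lam)

/-- The origin is a null set, so its count is Poisson of mean `0`. This excludes zero distances, at
which the path loss is degenerate. -/
lemma IsPoissonProcess.ae_ne_zero {Ω : Type*} [MeasurableSpace Ω] {μ : Measure Ω}
    [IsProbabilityMeasure μ] {X : ℕ → Ω → Plane} (hX : IsPoissonProcess μ X lam)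
    (hlam : 0 < lam) : ∀ᵐ ω ∂μ, ∀ k, X k ω ≠ 0 := by
  have hX' := hX.isPoissonWithIntensity hlam
  have h0 : (ENNReal.ofReal lam • volume : Measure Plane) {0} = 0 := by simp
  have h := hX'.measure_hitCount_eq (measurableSet_singleton (0 : Plane))
    (by rw [h0]; exact ENNReal.zero_ne_top) 0
  rw [h0] at h
  have h1 : μ (hitCount X {0} ⁻¹' {0}) = 1 := by simpa using h
  have h2 := (mem_ae_iff_prob_eq_one (hX'.measurable_hitCount (measurableSet_singleton (0 : Plane))
    (measurableSet_singleton 0))).2 h1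
  filter_upwards [h2] with ω hω k hk
  exact hitCount_eq_zero_iff.1 hω k hk

end SquaredDistance

/-! ### Measurability of the smallest minimizer -/

lemma measurable_argminIndex {E : Type*} [MeasurableSpace E] {u : ℕ → E → ℝ}
    (hu : ∀ j, Measurable (u j)) : Measurable fun x => argminIndex fun j => u j x := by
  have hS : ∀ k, MeasurableSet {x | ∀ j, u k x ≤ u j x} := fun k => by
    rw [Set.ofPred_forall]
    exact MeasurableSet.iInter fun j => measurableSet_le (hu k) (hu j)
  refine measurable_to_countable' fun n => ?_
  -- The second piece accounts for `sInf ∅ = 0`: without a minimizer the index is `0`.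
  have h : (fun x => argminIndex fun j => u j x) ⁻¹' {n} =
      ({x | ∀ j, u n x ≤ u j x} ∩ ⋂ i, ⋂ (_ : i < n), {x | ∀ j, u i x ≤ u j x}ᶜ) ∪
        ({_x | n = 0} ∩ ⋂ i, {x | ∀ j, u i x ≤ u j x}ᶜ) := by
    ext x
    simp only [Set.mem_preimage, Set.mem_singleton_iff, Set.mem_union, Set.mem_inter_iff,
      Set.mem_iInter, Set.mem_compl_iff, Set.mem_ofPred_eq]
    constructor
    · rintro rfl
      by_cases hne : ∃ k, ∀ j, u k x ≤ u j x
      · exact Or.inl ⟨Nat.sInf_mem (s := {k | ∀ j, u k x ≤ u j x}) hne,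
          fun i hi => Nat.notMem_of_lt_sInf (s := {k | ∀ j, u k x ≤ u j x}) hi⟩
      · refine Or.inr ⟨?_, fun i hi => hne ⟨i, hi⟩⟩
        refine Nat.sInf_eq_zero.2 (Or.inr (Set.eq_empty_of_forall_notMem fun i hi => hne ⟨i, hi⟩))
    · rintro (⟨hn, hlt⟩ | ⟨rfl, hn⟩)
      · refine le_antisymm (Nat.sInf_le (s := {k | ∀ j, u k x ≤ u j x}) hn) ?_
        by_contra hc
        exact hlt _ (not_le.1 hc) (Nat.sInf_mem (s := {k | ∀ j, u k x ≤ u j x}) ⟨n, hn⟩)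
      · exact Nat.sInf_eq_zero.2 (Or.inr (Set.eq_empty_of_forall_notMem hn))
  rw [h]
  exact ((hS n).inter (MeasurableSet.iInter fun i => MeasurableSet.iInter fun _ =>
    (hS i).compl)).union ((MeasurableSet.const _).inter (MeasurableSet.iInter fun i => (hS i).compl))

lemma measurable_apply_index {E F : Type*} [MeasurableSpace E] [MeasurableSpace F] {k : E → ℕ}
    {x : E → ℕ → F} (hk : Measurable k) (hx : Measurable x) : Measurable fun z => x z (k z) := by
  have h : Measurable fun q : ℕ × (ℕ → F) => q.2 q.1 :=
    measurable_from_prod_countable_right measurable_pi_apply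
  exact h.comp (hk.prodMk hx)

/-! ### The network as a function of locations and marks -/

namespace RISParams

variable (P : RISParams)

/-- The power received from an interferer at distance `d` with mark `m`. -/
noncomputable def interferencePower (d : ℝ) (m : Bool × ℝ × ℝ × ℝ × ℝ) : ℝ :=
  if m.1 then P.e1 * d ^ (-P.α) * m.2.2.2.1 else P.Cd * d ^ (-P.α) * m.2.2.2.2

/-- The normalized power of a serving transmitter with mark `m`. -/
noncomputable def signalPower (m : Bool × ℝ × ℝ × ℝ × ℝ) : ℝ := if m.1 then m.2.1 else m.2.2.1

/-- The index of the nearest transmitter. -/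
noncomputable def nearestIndex (x : ℕ → Plane) : ℕ := argminIndex fun j => ‖x j‖

/-- The interference divided by the direct path loss of the serving transmitter. -/
noncomputable def interferenceRatio (x : ℕ → Plane) (m : ℕ → Bool × ℝ × ℝ × ℝ × ℝ) : ℝ≥0∞ :=
  ENNReal.ofReal (‖x (nearestIndex x)‖ ^ P.α / P.Cd) *
    ∑' j, if j = nearestIndex x then 0
      else ENNReal.ofReal (P.interferencePower ‖x j‖ (m j))

lemma measurableSet_fst_true : MeasurableSet {m : Bool × ℝ × ℝ × ℝ × ℝ | m.1 = true} :=
  measurable_fst (MeasurableSet.of_discrete (s := {true}))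

lemma measurable_signalPower : Measurable signalPower :=
  Measurable.ite measurableSet_fst_true (by fun_prop) (by fun_prop)

lemma measurable_interferencePower :
    Measurable fun z : ℝ × (Bool × ℝ × ℝ × ℝ × ℝ) => P.interferencePower z.1 z.2 :=
  Measurable.ite (measurable_snd measurableSet_fst_true) (by fun_prop) (by fun_prop)

lemma measurable_nearestIndex : Measurable nearestIndex :=
  measurable_argminIndex fun j => (measurable_pi_apply j).norm

lemma measurable_interferenceRatio :
    Measurable fun z : (ℕ → Plane) × (ℕ → Bool × ℝ × ℝ × ℝ × ℝ) =>
      P.interferenceRatio z.1 z.2 := by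
  have hk : Measurable fun z : (ℕ → Plane) × (ℕ → Bool × ℝ × ℝ × ℝ × ℝ) => nearestIndex z.1 :=
    measurable_nearestIndex.comp measurable_fst
  have hr : Measurable fun z : (ℕ → Plane) × (ℕ → Bool × ℝ × ℝ × ℝ × ℝ) =>
      ‖z.1 (nearestIndex z.1)‖ := (measurable_apply_index hk measurable_fst).norm
  have hset : ∀ j, MeasurableSet {z : (ℕ → Plane) × (ℕ → Bool × ℝ × ℝ × ℝ × ℝ) |
      j = nearestIndex z.1} := fun j => measurableSet_eq_fun measurable_const hk
  have harg : ∀ j, Measurable fun z : (ℕ → Plane) × (ℕ → Bool × ℝ × ℝ × ℝ × ℝ) =>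
      (‖z.1 j‖, z.2 j) := fun j =>
    (((measurable_pi_apply j).comp measurable_fst).norm).prodMk
      ((measurable_pi_apply j).comp measurable_snd)
  have hpow : ∀ j, Measurable fun z : (ℕ → Plane) × (ℕ → Bool × ℝ × ℝ × ℝ × ℝ) =>
      ENNReal.ofReal (P.interferencePower ‖z.1 j‖ (z.2 j)) := fun j =>
    ENNReal.measurable_ofReal.comp (P.measurable_interferencePower.comp (harg j))
  have hsum : Measurable fun z : (ℕ → Plane) × (ℕ → Bool × ℝ × ℝ × ℝ × ℝ) =>
      ∑' j, if j = nearestIndex z.1 then 0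
        else ENNReal.ofReal (P.interferencePower ‖z.1 j‖ (z.2 j)) :=
    Measurable.tsum fun j => Measurable.ite (hset j) measurable_const (hpow j)
  have hfac : Measurable fun z : (ℕ → Plane) × (ℕ → Bool × ℝ × ℝ × ℝ × ℝ) =>
      ENNReal.ofReal (‖z.1 (nearestIndex z.1)‖ ^ P.α / P.Cd) :=
    ENNReal.measurable_ofReal.comp ((hr.pow_const _).div_const _)
  exact hfac.mul hsum

variable {P}

/-- The Laplace transform of the interference ratio given the locations. -/
lemma Admissible.lintegral_nexp_interferenceRatio (hP : P.Admissible) {lam : ℝ} (hlam : 0 < lam)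
    {x : ℕ → Plane} (hx : ∀ k, x k ≠ 0) {t : ℝ} (ht : 0 ≤ t) :
    ∫⁻ m, nexp (ENNReal.ofReal t * P.interferenceRatio x m)
        ∂(Measure.infinitePi fun _ : ℕ => P.markLaw) =
      ratioFactor (logFactor P.p (P.e1 / P.Cd * t) t (P.α / 2)) (fun j => discCount lam (x j)) := by
  have := hP.isProbabilityMeasure_markLaw
  have hCd := hP.Cd_pos
  have he1 := hP.e1_pos
  have hpos : ∀ k, 0 < ‖x k‖ := fun k => norm_pos_iff.2 (hx k)
  have hk : argminIndex (fun j => discCount lam (x j)) = nearestIndex x := by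
    simp only [nearestIndex, argminIndex, discCount_le_iff hlam]
  set k := nearestIndex x with hkdef
  set s : ℝ := t * (‖x k‖ ^ P.α / P.Cd) with hs
  have hr0 : 0 < ‖x k‖ ^ P.α := Real.rpow_pos_of_pos (hpos k) _
  have hs0 : 0 ≤ s := by positivity
  have hd0 : ∀ j, 0 < ‖x j‖ ^ (-P.α) := fun j => Real.rpow_pos_of_pos (hpos j) _
  have h1 : ∀ m : ℕ → Bool × ℝ × ℝ × ℝ × ℝ,
      ENNReal.ofReal t * P.interferenceRatio x m = ∑' j, if j = k then 0 else
        ENNReal.ofReal (if (m j).1 then s * (P.e1 * ‖x j‖ ^ (-P.α)) * (m j).2.2.2.1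
          else s * (P.Cd * ‖x j‖ ^ (-P.α)) * (m j).2.2.2.2) := by
    intro m
    rw [interferenceRatio, ← mul_assoc, ← ENNReal.ofReal_mul ht, ← ENNReal.tsum_mul_left]
    refine tsum_congr fun j => ?_
    rw [← hkdef, ← hs, mul_ite, mul_zero]
    by_cases hj : j = k
    · rw [if_pos hj, if_pos hj]
    · rw [if_neg hj, if_neg hj, ← ENNReal.ofReal_mul hs0, interferencePower, mul_ite]
      simp only [mul_assoc]
  simp_rw [h1]
  rw [ratioFactor, hk]
  refine lintegral_nexp_tsum_infinitePi
    (f := fun (j : ℕ) (m : Bool × ℝ × ℝ × ℝ × ℝ) => if j = k then 0 else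
      ENNReal.ofReal (if m.1 then s * (P.e1 * ‖x j‖ ^ (-P.α)) * m.2.2.2.1
        else s * (P.Cd * ‖x j‖ ^ (-P.α)) * m.2.2.2.2)) (fun j => ?_) (fun j => ?_)
  · by_cases hj : j = k
    · simp only [hj, if_true]; exact measurable_const
    · simp only [hj, if_false]
      exact ENNReal.measurable_ofReal.comp
        (Measurable.ite measurableSet_fst_true (by fun_prop) (by fun_prop))
  · by_cases hj : j = k
    · simp only [hj, if_true, nexp_zero, lintegral_one, measure_univ]
    · simp only [hj, if_false]
      have hdj := hd0 j
      have hU : 0 < discCount lam (x j) / discCount lam (x k) := by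
        have := hpos j
        have := hpos k
        unfold discCount
        positivity
      rw [hP.lintegral_nexp_interferer (by positivity) (by positivity),
        nexp_logFactor P.p.2 (by positivity) ht hU, meanFactor]
      -- The factor `λπ` cancels in the ratio; this is why the density leaves the result.
      have hrat : (discCount lam (x j) / discCount lam (x k)) ^ (-(P.α / 2)) =
          ‖x k‖ ^ P.α * ‖x j‖ ^ (-P.α) := by
        have h2 : discCount lam (x j) / discCount lam (x k) = (‖x j‖ / ‖x k‖) ^ (2 : ℝ) := by
          have := (hpos k).ne'
          rw [Real.rpow_two]
          unfold discCount
          field_simp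
        rw [h2, ← Real.rpow_mul (by positivity), show 2 * -(P.α / 2) = -P.α by ring,
          Real.div_rpow (hpos j).le (hpos k).le, Real.rpow_neg (hpos k).le, div_inv_eq_mul,
          mul_comm]
      rw [hrat]
      have ha : s * (P.e1 * ‖x j‖ ^ (-P.α)) =
          P.e1 / P.Cd * t * (‖x k‖ ^ P.α * ‖x j‖ ^ (-P.α)) := by rw [hs]; ring
      have hb : s * (P.Cd * ‖x j‖ ^ (-P.α)) = t * (‖x k‖ ^ P.α * ‖x j‖ ^ (-P.α)) := by
        rw [hs]; field_simp
      rw [ha, hb]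

/-- `Y₂`, and `Y₁` up to scaling, as functions of the Laplace variable. -/
noncomputable def hypMixture (P : RISParams) (t : ℝ) : ℝ :=
  P.p * P.hyp (-(P.e1 / P.Cd * t)) + (1 - P.p) * P.hyp (-t)

lemma Admissible.hyp_neg_eq (hP : P.Admissible) {y : ℝ} (hy : 0 ≤ y) :
    P.hyp (-y) = 1 + ∫ u in Set.Ioi (1 : ℝ), y * (u ^ (P.α / 2) + y)⁻¹ := by
  have h := gaussHypergeometric_neg_eq (a := P.α / 2) (by linarith [hP.two_lt_α]) hy
  rwa [one_div_div] at h

lemma integral_tail_nonneg {a y : ℝ} (hy : 0 ≤ y) :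
    0 ≤ ∫ u in Set.Ioi (1 : ℝ), y * (u ^ a + y)⁻¹ := by
  refine setIntegral_nonneg measurableSet_Ioi fun u hu => ?_
  have : 0 < u ^ a := Real.rpow_pos_of_pos (one_pos.trans hu) _
  positivity

lemma Admissible.one_le_hypMixture (hP : P.Admissible) {t : ℝ} (ht : 0 ≤ t) :
    1 ≤ P.hypMixture t := by
  have hx : 0 ≤ P.e1 / P.Cd * t := mul_nonneg (div_nonneg hP.e1_pos.le hP.Cd_pos.le) ht
  rw [hypMixture, hP.hyp_neg_eq hx, hP.hyp_neg_eq ht]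
  have h1 := mul_nonneg P.p.2.1 (integral_tail_nonneg (a := P.α / 2) hx)
  have h2 := mul_nonneg (sub_nonneg.2 P.p.2.2) (integral_tail_nonneg (a := P.α / 2) ht)
  linarith

end RISParams

/-! ### The random interference ratio and its Laplace transform -/

namespace RISNetwork

variable {Ω : Type*} {net : RISNetwork Ω} {P : RISParams}

/-- The interference divided by the direct path loss of the serving transmitter. -/
noncomputable def interferenceRatio (net : RISNetwork Ω) (P : RISParams) (ω : Ω) : ℝ≥0∞ :=
  P.interferenceRatio (fun k => net.loc k ω) (fun k => net.mark k ω)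

lemma etaG_add_mul_etaH (hP : P.Admissible) {d : ℝ} (hd : 0 ≤ d) :
    P.etaG d + P.N * P.etaH d = P.e1 * d ^ (-P.α) := by
  unfold RISParams.etaG RISParams.etaH RISParams.e1
  rw [Real.mul_rpow hP.d0_pos.le hd]
  ring

lemma interference_nearest (hP : P.Admissible) (ω : Ω) :
    net.interference P (net.nearest ω) ω =
      ∑' j, if j = RISParams.nearestIndex (fun k => net.loc k ω) then 0
        else ENNReal.ofReal (P.interferencePower ‖net.loc j ω‖ (net.mark j ω)) := by
  unfold interference
  refine tsum_congr fun j => ?_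
  have h1 : net.nearest ω = RISParams.nearestIndex (fun k => net.loc k ω) := rfl
  rw [h1]
  congr 2
  unfold interferer RISParams.interferencePower
  have hd : net.dist j ω = ‖net.loc j ω‖ := rfl
  rw [hd, etaG_add_mul_etaH hP (norm_nonneg _)]
  rfl

/-- Without noise, coverage is an inequality between the normalized powers. -/
lemma lt_sinr_zero_iff (hP : P.Admissible) {T : ℝ} (hT : 0 < T) {ω : Ω}
    (hω : ∀ k, net.loc k ω ≠ 0) :
    ENNReal.ofReal T < net.sinr P 0 ω ↔
      ENNReal.ofReal T * net.interferenceRatio P ω < ENNReal.ofReal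
        (RISParams.signalPower
          (net.mark (RISParams.nearestIndex fun k => net.loc k ω) ω)) := by
  have hCd := hP.Cd_pos
  set k := RISParams.nearestIndex fun k => net.loc k ω with hk
  have hr : 0 < ‖net.loc k ω‖ := norm_pos_iff.2 (hω k)
  set g : ℝ := P.Cd * ‖net.loc k ω‖ ^ (-P.α) with hg
  have hg0 : 0 < g := mul_pos hCd (Real.rpow_pos_of_pos hr _)
  have hginv : ‖net.loc k ω‖ ^ P.α / P.Cd = g⁻¹ := by
    rw [hg, mul_inv, Real.rpow_neg hr.le, inv_inv]
    field_simp
  have hI := interference_nearest (net := net) hP ω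
  rw [← hk] at hI
  set I := net.interference P (net.nearest ω) ω with hIdef
  have hW : net.interferenceRatio P ω = ENNReal.ofReal g⁻¹ * I := by
    rw [hI, ← hginv]; rfl
  have hS : net.signal P (net.nearest ω) ω = g * RISParams.signalPower (net.mark k ω) := rfl
  have hT0 : ENNReal.ofReal T ≠ 0 := by simpa using hT
  have hgE : ENNReal.ofReal g ≠ 0 := by simpa using hg0
  -- The interference may be `0` or `∞`. The division can still be cleared because the signal is
  -- finite and `T` is nonzero.
  rw [sinr, ← hIdef, hS, ENNReal.ofReal_zero, add_zero,
    ENNReal.lt_div_iff_mul_lt (Or.inr ENNReal.ofReal_ne_top) (Or.inr hT0), hW,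
    ENNReal.ofReal_mul hg0.le,
    ← ENNReal.mul_lt_mul_iff_right hgE ENNReal.ofReal_ne_top
      (b := ENNReal.ofReal T * (ENNReal.ofReal g⁻¹ * I))]
  have hcancel : ENNReal.ofReal g * (ENNReal.ofReal T * (ENNReal.ofReal g⁻¹ * I)) =
      ENNReal.ofReal T * I := by
    rw [mul_left_comm, ← mul_assoc (ENNReal.ofReal g), ← ENNReal.ofReal_mul hg0.le,
      mul_inv_cancel₀ hg0.ne', ENNReal.ofReal_one, one_mul]
  rw [hcancel]

variable [MeasurableSpace Ω] {μ : Measure Ω} {lam : ℝ}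

lemma HasLaw.measurable_loc (h : net.HasLaw P μ lam) : Measurable fun ω k => net.loc k ω :=
  measurable_pi_lambda _ h.poisson.measurable

lemma HasLaw.measurable_marks (h : net.HasLaw P μ lam) : Measurable fun ω k => net.mark k ω :=
  measurable_pi_lambda _ h.measurable_mark

lemma HasLaw.measurable_interferenceRatio (h : net.HasLaw P μ lam) :
    Measurable (net.interferenceRatio P) := by
  have e : net.interferenceRatio P = (fun z : (ℕ → Plane) × (ℕ → Bool × ℝ × ℝ × ℝ × ℝ) =>
      P.interferenceRatio z.1 z.2) ∘ fun ω => (fun k => net.loc k ω, fun k => net.mark k ω) := rfl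
  rw [e]
  exact P.measurable_interferenceRatio.comp (h.measurable_loc.prodMk h.measurable_marks)

variable [IsProbabilityMeasure μ]

/-- Integration over the marks given the locations. -/
lemma HasLaw.lintegral_eq (h : net.HasLaw P μ lam) (hP : P.Admissible)
    {Φ : (ℕ → Plane) × (ℕ → Bool × ℝ × ℝ × ℝ × ℝ) → ℝ≥0∞} (hΦ : Measurable Φ) :
    ∫⁻ ω, Φ (fun k => net.loc k ω, fun k => net.mark k ω) ∂μ =
      ∫⁻ ω, ∫⁻ m, Φ (fun k => net.loc k ω, m)
        ∂(Measure.infinitePi fun _ : ℕ => P.markLaw) ∂μ := by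
  have := hP.isProbabilityMeasure_markLaw
  have hM : μ.map (fun ω k => net.mark k ω) = Measure.infinitePi fun _ : ℕ => P.markLaw := by
    rw [h.indep_mark.map_fun_eq_infinitePi_map h.measurable_mark]
    congr 1
    exact funext h.map_mark
  have hprod := (indepFun_iff_map_prod_eq_prod_map_map h.measurable_loc.aemeasurable
    h.measurable_marks.aemeasurable).1 h.indep_loc_mark
  rw [← lintegral_map hΦ (h.measurable_loc.prodMk h.measurable_marks), hprod, hM,
    lintegral_prod _ hΦ.aemeasurable, lintegral_map hΦ.lintegral_prod_right' h.measurable_loc]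

/-- The Laplace transform of the interference ratio. -/
lemma HasLaw.lintegral_nexp_interferenceRatio (h : net.HasLaw P μ lam) (hP : P.Admissible)
    (hlam : 0 < lam) {t : ℝ} (ht : 0 ≤ t) :
    ∫⁻ ω, nexp (ENNReal.ofReal t * net.interferenceRatio P ω) ∂μ =
      ENNReal.ofReal (P.hypMixture t)⁻¹ := by
  have hx : 0 ≤ P.e1 / P.Cd * t := mul_nonneg (div_nonneg hP.e1_pos.le hP.Cd_pos.le) ht
  have ha : 1 < P.α / 2 := by linarith [hP.two_lt_α]
  have h1 := h.lintegral_eq hP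
    (Φ := fun z => nexp (ENNReal.ofReal t * P.interferenceRatio z.1 z.2))
    (measurable_nexp.comp (P.measurable_interferenceRatio.const_mul _))
  refine h1.trans ?_
  have h2 : ∀ᵐ ω ∂μ, ∫⁻ m, nexp (ENNReal.ofReal t *
      P.interferenceRatio (fun k => net.loc k ω) m)
        ∂(Measure.infinitePi fun _ : ℕ => P.markLaw) =
      ratioFactor (logFactor P.p (P.e1 / P.Cd * t) t (P.α / 2))
        (fun j => discCount lam (net.loc j ω)) := by
    filter_upwards [h.poisson.ae_ne_zero hlam] with ω hω
    exact hP.lintegral_nexp_interferenceRatio hlam hω ht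
  rw [lintegral_congr_ae h2]
  have hi1 := mul_nonneg P.p.2.1 (RISParams.integral_tail_nonneg (a := P.α / 2) hx)
  have hi2 := mul_nonneg (sub_nonneg.2 P.p.2.2)
    (RISParams.integral_tail_nonneg (a := P.α / 2) ht)
  rw [lintegral_ratioFactor (h.poisson.discCount hlam)
    (fun k ω => discCount_nonneg hlam _) measurable_logFactor
    (antitoneOn_logFactor P.p.2 hx ht (by linarith)) (add_nonneg hi1 hi2)
    (lintegral_one_sub_nexp_logFactor P.p.2 hx ht ha)]
  congr 2
  rw [RISParams.hypMixture, hP.hyp_neg_eq hx, hP.hyp_neg_eq ht]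
  ring

/-! ### Coverage -/

/-- Coverage without noise, after integration over the signal of the serving transmitter. -/
lemma HasLaw.measure_lt_sinr_zero (h : net.HasLaw P μ lam) (hP : P.Admissible) (hlam : 0 < lam)
    {T : ℝ} (hT : 0 < T) :
    μ {ω | ENNReal.ofReal T < net.sinr P 0 ω} =
      ∫⁻ ω, (ENNReal.ofReal P.p * gammaTail P.kappaHat (ENNReal.ofReal (1 / P.chiBar) *
          (ENNReal.ofReal T * net.interferenceRatio P ω)) +
        ENNReal.ofReal (1 - P.p) * nexp (ENNReal.ofReal T * net.interferenceRatio P ω)) ∂μ := by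
  have := hP.isProbabilityMeasure_markLaw
  let A : Set ((ℕ → Plane) × (ℕ → Bool × ℝ × ℝ × ℝ × ℝ)) :=
    {z | ENNReal.ofReal T * P.interferenceRatio z.1 z.2 <
      ENNReal.ofReal (RISParams.signalPower (z.2 (RISParams.nearestIndex z.1)))}
  have hk : Measurable fun z : (ℕ → Plane) × (ℕ → Bool × ℝ × ℝ × ℝ × ℝ) =>
      RISParams.nearestIndex z.1 := RISParams.measurable_nearestIndex.comp measurable_fst
  have hA : MeasurableSet A := measurableSet_lt (P.measurable_interferenceRatio.const_mul _)
    (ENNReal.measurable_ofReal.comp (RISParams.measurable_signalPower.comp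
      (measurable_apply_index hk measurable_snd)))
  let B : Set Ω := (fun ω => ((fun k => net.loc k ω : ℕ → Plane),
    (fun k => net.mark k ω : ℕ → Bool × ℝ × ℝ × ℝ × ℝ))) ⁻¹' A
  have hB : MeasurableSet B := (h.measurable_loc.prodMk h.measurable_marks) hA
  have hae : {ω | ENNReal.ofReal T < net.sinr P 0 ω} =ᵐ[μ] B := by
    filter_upwards [h.poisson.ae_ne_zero hlam] with ω hω
    exact propext (lt_sinr_zero_iff hP hT hω)
  -- The conditional coverage probability given that `T` times the interference ratio is `V`.
  let Ψ : ℝ≥0∞ → ℝ≥0∞ := fun V => ENNReal.ofReal P.p * gammaTail P.kappaHat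
    (ENNReal.ofReal (1 / P.chiBar) * V) + ENNReal.ofReal (1 - P.p) * nexp V
  have hΨ : Measurable Ψ :=
    (((measurable_gammaTail _).comp (measurable_id.const_mul _)).const_mul _).add
      (measurable_nexp.const_mul _)
  rw [measure_congr hae, ← lintegral_indicator_one hB]
  have h1 := h.lintegral_eq hP (Φ := A.indicator 1) (measurable_one.indicator hA)
  have h2 := h.lintegral_eq hP
    (Φ := fun z => Ψ (ENNReal.ofReal T * P.interferenceRatio z.1 z.2))
    (hΨ.comp (P.measurable_interferenceRatio.const_mul _))
  refine Eq.trans ?_ (h1.trans (Eq.trans ?_ h2.symm))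
  · rfl
  · refine lintegral_congr fun ω => ?_
    set x : ℕ → Plane := fun k => net.loc k ω with hx
    have hAx : MeasurableSet {m : ℕ → Bool × ℝ × ℝ × ℝ × ℝ | (x, m) ∈ A} :=
      measurable_prodMk_left hA
    have h3 : (fun m => A.indicator (1 : (ℕ → Plane) × (ℕ → Bool × ℝ × ℝ × ℝ × ℝ) → ℝ≥0∞) (x, m)) =
        {m : ℕ → Bool × ℝ × ℝ × ℝ × ℝ | (x, m) ∈ A}.indicator 1 := rfl
    rw [h3, lintegral_indicator_one hAx]
    -- With the locations frozen the serving index is deterministic, so its mark is independent of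
    -- the sum over the others.
    have h4 := infinitePi_tsum_lt (ν := P.markLaw)
      (f := fun j m => ENNReal.ofReal (P.interferencePower ‖x j‖ m))
      (fun j => ENNReal.measurable_ofReal.comp
        (P.measurable_interferencePower.comp (measurable_const.prodMk measurable_id)))
      (ENNReal.ofReal T * ENNReal.ofReal (‖x (RISParams.nearestIndex x)‖ ^ P.α / P.Cd))
      (σ := fun m => ENNReal.ofReal (RISParams.signalPower m))
      (ENNReal.measurable_ofReal.comp RISParams.measurable_signalPower)
      (RISParams.nearestIndex x)
    simp only [mul_assoc] at h4
    refine Eq.trans ?_ (h4.trans ?_)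
    · rfl
    · refine lintegral_congr fun m => ?_
      exact hP.markLaw_lt_signal _

/-- The coverage probability converges to that without noise. -/
lemma tendsto_coverage (net : RISNetwork Ω) (P : RISParams) (T : ℝ) :
    Tendsto (fun γ : ℝ => net.coverage P μ γ⁻¹ T) atTop (𝓝 (net.coverage P μ 0 T)) := by
  -- Truncation at `1` makes the noise antitone in `γ` on the whole line and changes nothing for
  -- large `γ`.
  let S : ℝ → Set Ω := fun γ => {ω | ENNReal.ofReal T < net.sinr P (max γ 1)⁻¹ ω}
  have hmono : Monotone S := by
    intro γ γ' hγ ω hω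
    change ENNReal.ofReal T < _ at hω
    refine lt_of_lt_of_le hω ?_
    unfold sinr
    gcongr
  have hunion : ⋃ γ, S γ = {ω | ENNReal.ofReal T < net.sinr P 0 ω} := by
    ext ω
    rw [Set.mem_iUnion]
    constructor
    · rintro ⟨γ, hγ⟩
      change ENNReal.ofReal T < _ at hγ
      refine lt_of_lt_of_le hγ ?_
      unfold sinr
      gcongr
      positivity
    · intro hω
      have hlim : Tendsto (fun γ : ℝ => net.sinr P (max γ 1)⁻¹ ω) atTop (𝓝 (net.sinr P 0 ω)) := by
        -- A nonzero signal excludes `0 / 0`, so the ratio is continuous in the noise at `0` even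
        -- without interference.
        have hS : ENNReal.ofReal (net.signal P (net.nearest ω) ω) ≠ 0 := by
          intro h0
          change ENNReal.ofReal T < net.sinr P 0 ω at hω
          rw [sinr, h0, ENNReal.zero_div] at hω
          exact not_lt_zero hω
        have h1 : Tendsto (fun γ : ℝ => (max γ 1)⁻¹) atTop (𝓝 0) :=
          tendsto_inv_atTop_zero.comp (tendsto_atTop_mono (fun γ => le_max_left γ 1) tendsto_id)
        exact ENNReal.Tendsto.div tendsto_const_nhds (Or.inl hS)
          (tendsto_const_nhds.add (ENNReal.tendsto_ofReal h1)) (Or.inr ENNReal.ofReal_ne_top)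
      obtain ⟨γ, hγ⟩ := (hlim.eventually (lt_mem_nhds hω)).exists
      exact ⟨γ, hγ⟩
  have key := tendsto_measure_iUnion_atTop (μ := μ) hmono
  rw [hunion] at key
  have key' := (ENNReal.tendsto_toReal (measure_ne_top μ _)).comp key
  refine key'.congr' ?_
  filter_upwards [eventually_ge_atTop 1] with γ hγ
  simp only [Function.comp_apply, S, max_eq_left hγ]
  rfl

end RISNetwork

/-! ### The coverage formula -/

theorem proposition6 (P : RISParams) (hP : P.Admissible)
    {Ω : Type*} [MeasurableSpace Ω] (μ : Measure Ω) [IsProbabilityMeasure μ]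
    (lam : ℝ) (hlam : 0 < lam) (net : RISNetwork Ω) (hnet : net.HasLaw P μ lam)
    (T : ℝ) (hT : 0 < T) :
    net.coverage P μ 0 T =
        P.p * ∑ i ∈ Finset.range P.kappaHat,
          (-1 : ℝ) ^ i / (i.factorial : ℝ) * iteratedDeriv i (fun s => (P.Y1 T s)⁻¹) 1
        + (1 - P.p) * (P.Y2 T)⁻¹ ∧
    Tendsto (fun γt : ℝ => net.coverage P μ γt⁻¹ T) atTop
      (𝓝 (P.p * ∑ i ∈ Finset.range P.kappaHat,
          (-1 : ℝ) ^ i / (i.factorial : ℝ) * iteratedDeriv i (fun s => (P.Y1 T s)⁻¹) 1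
        + (1 - P.p) * (P.Y2 T)⁻¹)) := by
  have hχ := hP.chiBar_pos
  have hCd := hP.Cd_pos
  have hW := hnet.measurable_interferenceRatio
  have hY2 : P.hypMixture T = P.Y2 T := by
    rw [RISParams.hypMixture, RISParams.Y2, div_mul_eq_mul_div]
  have hY1 : ∀ s, P.hypMixture (s * (T / P.chiBar)) = P.Y1 T s := by
    intro s
    rw [RISParams.hypMixture, RISParams.Y1]
    congr 4
    · field_simp
    · ring
  have hY : Measurable fun ω => ENNReal.ofReal (T / P.chiBar) * net.interferenceRatio P ω :=
    hW.const_mul _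
  -- The scaling by `T / χ̄` is put into the variable, so that its Laplace transform is `Y_1(s)⁻¹`
  -- and the derivatives are taken at `s = 1`.
  have hderiv := lintegral_pow_mul_nexp (μ := μ) hY (L := fun s => (P.Y1 T s)⁻¹)
    (fun s hs => by
      rw [← hY1]
      exact inv_nonneg.2 (zero_le_one.trans (hP.one_le_hypMixture (by positivity))))
    (fun s hs => by
      rw [← hY1, ← hnet.lintegral_nexp_interferenceRatio hP hlam (by positivity)]
      simp_rw [← mul_assoc, ← ENNReal.ofReal_mul hs.le])
  have hmain : net.coverage P μ 0 T =
        P.p * ∑ i ∈ Finset.range P.kappaHat,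
          (-1 : ℝ) ^ i / (i.factorial : ℝ) * iteratedDeriv i (fun s => (P.Y1 T s)⁻¹) 1
        + (1 - P.p) * (P.Y2 T)⁻¹ := by
    have hY2pos : 0 ≤ (P.Y2 T)⁻¹ := by
      rw [← hY2]
      exact inv_nonneg.2 (zero_le_one.trans (hP.one_le_hypMixture hT.le))
    have hterm : ∀ i : ℕ, 0 ≤ (-1 : ℝ) ^ i / (i.factorial : ℝ) *
        iteratedDeriv i (fun s => (P.Y1 T s)⁻¹) 1 := by
      intro i
      rw [div_mul_eq_mul_div]
      exact div_nonneg (hderiv i).1 (Nat.cast_nonneg _)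
    rw [RISNetwork.coverage, measureReal_def, hnet.measure_lt_sinr_zero hP hlam hT]
    have hscale : ∀ ω, ENNReal.ofReal (1 / P.chiBar) *
        (ENNReal.ofReal T * net.interferenceRatio P ω) =
        ENNReal.ofReal (T / P.chiBar) * net.interferenceRatio P ω := by
      intro ω
      rw [← mul_assoc, ← ENNReal.ofReal_mul (by positivity), one_div_mul_eq_div]
    have hg : Measurable fun ω => gammaTail P.kappaHat
        (ENNReal.ofReal (T / P.chiBar) * net.interferenceRatio P ω) :=
      (measurable_gammaTail _).comp hY
    have he : Measurable fun ω => nexp (ENNReal.ofReal T * net.interferenceRatio P ω) :=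
      measurable_nexp.comp (hW.const_mul _)
    simp_rw [hscale]
    rw [lintegral_add_left (hg.const_mul _), lintegral_const_mul _ hg, lintegral_const_mul _ he,
      hnet.lintegral_nexp_interferenceRatio hP hlam hT.le, hY2]
    have hgamma : ∫⁻ ω, gammaTail P.kappaHat
        (ENNReal.ofReal (T / P.chiBar) * net.interferenceRatio P ω) ∂μ =
        ENNReal.ofReal (∑ i ∈ Finset.range P.kappaHat,
          (-1 : ℝ) ^ i / (i.factorial : ℝ) * iteratedDeriv i (fun s => (P.Y1 T s)⁻¹) 1) := by
      unfold gammaTail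
      have hpm : ∀ i : ℕ, Measurable fun ω =>
          (ENNReal.ofReal (T / P.chiBar) * net.interferenceRatio P ω) ^ i *
            nexp (ENNReal.ofReal (T / P.chiBar) * net.interferenceRatio P ω) := fun i =>
        (hY.pow_const i).mul (measurable_nexp.comp hY)
      rw [lintegral_finsetSum _ fun i _ => (hpm i).const_mul _,
        ENNReal.ofReal_sum_of_nonneg fun i _ => hterm i]
      refine Finset.sum_congr rfl fun i _ => ?_
      rw [lintegral_const_mul _ (hpm i), (hderiv i).2,
        ← ENNReal.ofReal_mul (by positivity)]
      congr 1
      ring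
    have hp := P.p.2.1
    have hp' := sub_nonneg.2 P.p.2.2
    have hsum := Finset.sum_nonneg fun i (_ : i ∈ Finset.range P.kappaHat) => hterm i
    rw [hgamma, ← ENNReal.ofReal_mul hp, ← ENNReal.ofReal_mul hp',
      ← ENNReal.ofReal_add (mul_nonneg hp hsum) (mul_nonneg hp' hY2pos), ENNReal.toReal_ofReal
        (add_nonneg (mul_nonneg hp hsum) (mul_nonneg hp' hY2pos))]
  refine ⟨hmain, ?_⟩
  rw [← hmain]
  exact RISNetwork.tendsto_coverage net P T
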